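/- For $n\ge 1$ let $2n$ applicants have absolute ranks $R_1,\dots,R_{2n}$, a uniformly random ordering of $1,1,2,2,\dots,n,n$ (each of the $(2n)!/2^n$ orderings has probability $2^n/(2n)!$). Let $X_j$ be the number of different values in $\{R_i: i\le j,\ R_i\le R_j\}$, $D_j$ the number of different values in $\{R_1,\dots,R_j\}$, and $\mathcal F_j$ the $\sigma$-algebra generated by $(X_1,D_1),\dots,(X_j,D_j)$. Let $p_n=\sup_\tau P(R_\tau=1)$, where $\tau$ ranges over all stopping times of $(\mathcal F_j)_{j=1}^{2n}$ with values in $\{1,\dots,2n\}$. Let $r_n$ be the least $i\in\{1,\dots,n\}$ with $$\frac{2n}{i}+\sum_{j=i+1}^{n}\frac1{j-1}\le 5 .$$ Then for every $n\ge1$ the supremum is attained, and $$p_n=\frac{1}{3n}\left\{\left(1-r_n+\sum_{i=1}^{r_n-1}\prod_{j=i}^{r_n-1}\frac{2(n-j)}{2(n-j)+1}\right)\left(3-\sum_{\ell=r_n}^{n-1}\frac1\ell\right)+2n+r_n\right\},$$ where empty sums are $0$. Moreover the limit $r=\lim_{n\to\infty} r_n/n$ exists, lies in $(0,1)$ and satisfies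 $re^{-2/r}=e^{-5}$, and $$\lim_{n\to\infty}p_n=r+\frac{4}{3r}\left[(1-r)^{3/2}-(1-r)^2\right]=0.767974\ldots,$$ i.e. this limit lies in $[0.767974,\,0.767975)$. -/

import Mathlib

open MeasureTheory ProbabilityTheory Filter Topology

namespace DupSecretary

/-- `s` is an ordering of the multiset `1, 1, 2, 2, …, n, n`: among its `2 * n` entries each of the
values `1, …, n` occurs exactly twice (by counting, there are no other values). -/
def IsArrangement (n : ℕ) (s : Fin (2 * n) → ℕ) : Prop :=
  ∀ k ∈ Finset.Icc 1 n, (Finset.univ.filter fun i => s i = k).card = 2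

/-- The relative rank `X_j` of the `j`-th applicant among the first `j` applicants: the number of
different values in `{s i : s i ≤ s j, i ≤ j}`. -/
def relRank {N : ℕ} (s : Fin N → ℕ) (j : Fin N) : ℕ :=
  (((Finset.Iic j).image s).filter fun v => v ≤ s j).card

/-- The number `D_j` of distinct absolute ranks among the first `j` applicants. -/
def numDistinct {N : ℕ} (s : Fin N → ℕ) (j : Fin N) : ℕ :=
  ((Finset.Iic j).image s).card

/-- What the manager observes at each interview: the process `(X_j, D_j)`. -/
def observation {Ω : Type*} {N : ℕ} (R : Ω → Fin N → ℕ) (j : Fin N) (ω : Ω) : ℕ × ℕ :=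
  (relRank (R ω) j, numDistinct (R ω) j)

theorem stronglyMeasurable_observation {Ω : Type*} [MeasurableSpace Ω] {N : ℕ}
    {R : Ω → Fin N → ℕ} (hR : Measurable R) (j : Fin N) :
    StronglyMeasurable (observation R j) := by
  have h : Measurable fun s : Fin N → ℕ => (relRank s j, numDistinct s j) :=
    measurable_of_countable _
  exact (h.comp hR).stronglyMeasurable

/-- The filtration `𝓕_j = σ((X_1, D_1), …, (X_j, D_j))`. -/
noncomputable def infoFiltration {Ω : Type*} [m : MeasurableSpace Ω] {N : ℕ}
    (R : Ω → Fin N → ℕ) (hR : Measurable R) : Filtration (Fin N) m :=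
  Filtration.natural (observation R) (stronglyMeasurable_observation hR)

/-- The success probabilities `P(R_τ = 1)`, where `τ` ranges over all finite stopping rules of the
filtration `𝓕`. -/
def successProbs {Ω : Type*} [MeasurableSpace Ω] (P : Measure Ω) {N : ℕ}
    (R : Ω → Fin N → ℕ) (hR : Measurable R) : Set ℝ :=
  {p | ∃ τ : Ω → Fin N,
    IsStoppingTime (infoFiltration R hR) (fun ω => (τ ω : WithTop (Fin N))) ∧
      p = P.real {ω | R ω (τ ω) = 1}}

/-- `sup_τ P(R_τ = 1)` over all finite stopping rules. -/
noncomputable def maxSuccessProb {Ω : Type*} [MeasurableSpace Ω] (P : Measure Ω) {N : ℕ}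
    (R : Ω → Fin N → ℕ) (hR : Measurable R) : ℝ :=
  sSup (successProbs P R hR)

/-- `α(i) = 2n/i + ∑_{j=i+1}^n 1/(j-1)`. -/
noncomputable def alpha (n i : ℕ) : ℝ :=
  2 * (n : ℝ) / (i : ℝ) + ∑ j ∈ Finset.Icc (i + 1) n, 1 / ((j : ℝ) - 1)

/-- `r_n`, the least `i ∈ {1, …, n}` with `α(i) ≤ 5` (for `n ≥ 1` there is one, as `α(n) = 2`). -/
noncomputable def threshold (n : ℕ) : ℕ :=
  sInf {i : ℕ | 1 ≤ i ∧ i ≤ n ∧ alpha n i ≤ 5}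

end DupSecretary

/-! The observations up to time j reveal exactly the pattern of the first j ranks, that is, their
order type with repetitions. The number of orderings extending a pattern of length j with d values
depends only on j and d (`IsPattern.card_leaves`). Hence, given the past, the next applicant repeats
a given value seen once with probability 1/(2n-j), and is new, in a uniform relative position, with
probability 2(n-d)/(2n-j). The smallest value so far has absolute rank 1 with probability d/n
(`IsPattern.sum_leaves_eq_one`).

So the optimal stopping problem depends only on d and on whether the smallest value has been seen
once (`valOnce`) or twice (`valTwice`); `IsPattern.bellman` is its optimality equation. Stopping at
a first appearance never pays, since a second one is still to come. Stopping at the second pays when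
`valTwice n d ≤ d / n`, which is the condition `alpha n d ≤ 5` (`valTwice_le`, `le_valTwice`). From
the threshold on, both values have closed forms. Below it their difference satisfies a first-order
recursion, and summing it gives `valTwice_zero`. `IsPattern.winCount_le` and
`IsPattern.winCount_optRule` give optimality on the tree of patterns, and `isGreatest_successProbs`
transfers it to stopping times.

For the limit, `alpha n ⌊xn⌋` tends to 2/x - log x, whose strict monotonicity forces the threshold
to be near rn. The sum of products telescopes to a single product, a ratio of Wallis products
tending to √(1-r). Enclosing r in an interval of length 10⁻⁷ gives the decimals. -/

namespace DupSecretary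

open Finset

/-! ### Patterns of an initial segment -/

/-- The order embedding of `ℕ` that skips the value `k`. -/
def skip (k v : ℕ) : ℕ := if k ≤ v then v + 1 else v

theorem skip_strictMono (k : ℕ) : StrictMono (skip k) := by
  intro a b h
  unfold skip
  split_ifs <;> omega

theorem skip_ne (k v : ℕ) : skip k v ≠ k := by
  unfold skip
  split_ifs <;> omega

/-- Append the letter `k` to a word of length `j`, as a value not seen before: the values that are
at least `k` move up by one. -/
def insertNew (j k : ℕ) (w : ℕ → ℕ) : ℕ → ℕ := Function.update (skip k ∘ w) j k

/-- Append the letter `k` to a word of length `j`, as a value seen before. -/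
def appendOld (j k : ℕ) (w : ℕ → ℕ) : ℕ → ℕ := Function.update w j k

/-- Number of different values in the first `j` letters. -/
def values (j : ℕ) (w : ℕ → ℕ) : ℕ := ((range j).image w).card

/-- Relative rank of the letter at position `i`. -/
def wordRank (w : ℕ → ℕ) (i : ℕ) : ℕ := (((range (i + 1)).image w).filter (· ≤ w i)).card

/-- Number of occurrences of `v` in the first `j` letters. -/
def occ (j : ℕ) (w : ℕ → ℕ) (v : ℕ) : ℕ := ((range j).filter fun i => w i = v).card

/-- The values which occur exactly once in the first `j` letters. -/
def singles (j : ℕ) (w : ℕ → ℕ) : Finset ℕ := ((range j).image w).filter fun v => occ j w v = 1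

/-- The first `j` letters of `w` are a pattern with `d` different values. -/
structure IsPattern (j d : ℕ) (w : ℕ → ℕ) : Prop where
  image_eq : (range j).image w = Icc 1 d
  occ_le : ∀ v, occ j w v ≤ 2

theorem IsPattern.values_eq {j d : ℕ} {w : ℕ → ℕ} (h : IsPattern j d w) : values j w = d := by
  simp [values, h.image_eq]

theorem isPattern_zero (w : ℕ → ℕ) : IsPattern 0 0 w := ⟨by simp, by simp [occ]⟩

theorem image_congr_range {j : ℕ} {f g : ℕ → ℕ} (h : ∀ i < j, f i = g i) :
    (range j).image f = (range j).image g :=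
  image_congr fun i hi => h i (by simpa using hi)

theorem occ_congr {j : ℕ} {f g : ℕ → ℕ} (h : ∀ i < j, f i = g i) (v : ℕ) :
    occ j f v = occ j g v := by
  unfold occ
  congr 1
  exact filter_congr fun i hi => by rw [h i (by simpa using hi)]

theorem occ_update (j k : ℕ) (f : ℕ → ℕ) (v : ℕ) :
    occ (j + 1) (Function.update f j k) v = occ j f v + if k = v then 1 else 0 := by
  have h : occ j (Function.update f j k) v = occ j f v :=
    occ_congr (fun i hi => Function.update_of_ne (by omega) _ _) v
  rw [← h]
  unfold occ
  rw [range_add_one, filter_insert]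
  simp only [Function.update_self]
  split_ifs with hk
  · rw [card_insert_of_notMem (by simp)]
  · simp

theorem image_update (j k : ℕ) (f : ℕ → ℕ) :
    (range (j + 1)).image (Function.update f j k) = insert k ((range j).image f) := by
  rw [range_add_one, image_insert, Function.update_self,
    image_congr_range (f := Function.update f j k) (g := f)
      fun i hi => Function.update_of_ne (by omega) _ _]

theorem occ_skip (j k : ℕ) (w : ℕ → ℕ) (v : ℕ) : occ j (skip k ∘ w) (skip k v) = occ j w v := by
  simp [occ, (skip_strictMono k).injective.eq_iff]

theorem occ_skip_self (j k : ℕ) (w : ℕ → ℕ) : occ j (skip k ∘ w) k = 0 := by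
  simp [occ, skip_ne]

theorem occ_insertNew_self (j k : ℕ) (w : ℕ → ℕ) : occ (j + 1) (insertNew j k w) k = 1 := by
  simp [insertNew, occ_update, occ_skip_self]

theorem occ_insertNew_skip (j k : ℕ) (w : ℕ → ℕ) (v : ℕ) :
    occ (j + 1) (insertNew j k w) (skip k v) = occ j w v := by
  simp [insertNew, occ_update, occ_skip, (skip_ne k v).symm]

theorem occ_appendOld (j k : ℕ) (w : ℕ → ℕ) (v : ℕ) :
    occ (j + 1) (appendOld j k w) v = occ j w v + if k = v then 1 else 0 :=
  occ_update _ _ _ _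

theorem eq_or_exists_skip (k v : ℕ) : v = k ∨ ∃ u, v = skip k u := by
  rcases lt_trichotomy v k with h | h | h
  · exact Or.inr ⟨v, by unfold skip; split_ifs <;> omega⟩
  · exact Or.inl h
  · exact Or.inr ⟨v - 1, by unfold skip; split_ifs <;> omega⟩

theorem IsPattern.insertNew {j d k : ℕ} {w : ℕ → ℕ} (h : IsPattern j d w)
    (hk : k ∈ Icc 1 (d + 1)) : IsPattern (j + 1) (d + 1) (insertNew j k w) := by
  rw [mem_Icc] at hk
  refine ⟨?_, fun v => ?_⟩
  · rw [DupSecretary.insertNew, image_update, ← image_image, h.image_eq]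
    ext v
    simp only [mem_insert, mem_image, mem_Icc]
    constructor
    · rintro (rfl | ⟨u, hu, rfl⟩)
      · exact hk
      · unfold skip; split_ifs <;> omega
    · intro hv
      rcases eq_or_exists_skip k v with rfl | ⟨u, rfl⟩
      · exact Or.inl rfl
      · refine Or.inr ⟨u, ?_, rfl⟩
        unfold skip at hv; split_ifs at hv <;> omega
  · rcases eq_or_exists_skip k v with rfl | ⟨u, rfl⟩
    · rw [occ_insertNew_self]; omega
    · rw [occ_insertNew_skip]; exact h.occ_le u

theorem IsPattern.mem_singles {j d : ℕ} {w : ℕ → ℕ} (h : IsPattern j d w) {v : ℕ} :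
    v ∈ singles j w ↔ v ∈ Icc 1 d ∧ occ j w v = 1 := by
  rw [singles, mem_filter, h.image_eq]

theorem IsPattern.appendOld {j d k : ℕ} {w : ℕ → ℕ} (h : IsPattern j d w)
    (hk : k ∈ singles j w) : IsPattern (j + 1) d (appendOld j k w) := by
  rw [h.mem_singles] at hk
  refine ⟨?_, fun v => ?_⟩
  · rw [DupSecretary.appendOld, image_update, h.image_eq, insert_eq_of_mem hk.1]
  · rw [occ_appendOld]
    split_ifs with hv
    · subst hv; omega
    · exact h.occ_le v

theorem IsPattern.one_le_occ {j d : ℕ} {w : ℕ → ℕ} (h : IsPattern j d w) {v : ℕ}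
    (hv : v ∈ Icc 1 d) : 1 ≤ occ j w v := by
  rw [← h.image_eq, mem_image] at hv
  obtain ⟨i, hi, hv⟩ := hv
  exact card_pos.2 ⟨i, by simp_all⟩

theorem IsPattern.sum_occ {j d : ℕ} {w : ℕ → ℕ} (h : IsPattern j d w) :
    ∑ v ∈ Icc 1 d, occ j w v = j := by
  have := card_eq_sum_card_image w (range j)
  rw [h.image_eq, card_range] at this
  exact this.symm

/-- Each value occurs once or twice, so adding one more copy of each single makes every value occur
twice. -/
theorem IsPattern.card_singles {j d : ℕ} {w : ℕ → ℕ} (h : IsPattern j d w) :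
    (singles j w).card + j = 2 * d := by
  have h1 : (singles j w).card = ∑ v ∈ Icc 1 d, if occ j w v = 1 then 1 else 0 := by
    rw [singles, h.image_eq, card_filter]
  have h2 : ∑ v ∈ Icc 1 d, ((if occ j w v = 1 then 1 else 0) + occ j w v) =
      ∑ v ∈ Icc 1 d, 2 := by
    refine sum_congr rfl fun v hv => ?_
    have := h.one_le_occ hv
    have := h.occ_le v
    split_ifs <;> omega
  rw [sum_add_distrib, h.sum_occ, ← h1] at h2
  simpa [mul_comm] using h2

theorem IsPattern.occ_eq_two {j d : ℕ} {w : ℕ → ℕ} (h : IsPattern j d w) (hj : j = 2 * d)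
    {v : ℕ} (hv : v ∈ Icc 1 d) : occ j w v = 2 := by
  have h1 := h.card_singles
  have h2 : singles j w = ∅ := card_eq_zero.1 (by omega)
  have h3 := h.one_le_occ hv
  have h4 := h.occ_le v
  by_contra h5
  have : v ∈ singles j w := h.mem_singles.2 ⟨hv, by omega⟩
  simp [h2] at this

theorem IsPattern.one_mem_singles_insertNew {j d k : ℕ} {w : ℕ → ℕ} (h : IsPattern j d w)
    (hk : k ∈ Icc 1 (d + 1)) :
    1 ∈ singles (j + 1) (DupSecretary.insertNew j k w) ↔ k = 1 ∨ 1 ∈ singles j w := by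
  rw [(h.insertNew hk).mem_singles, h.mem_singles]
  rw [mem_Icc] at hk
  by_cases h1 : k = 1
  · subst h1
    simp [occ_insertNew_self]
  · have h2 := occ_insertNew_skip j k w 1
    have h3 : skip k 1 = 1 := by unfold skip; split_ifs <;> omega
    rw [h3] at h2
    rw [h2]
    simp only [mem_Icc, h1, false_or]
    constructor
    · rintro ⟨-, h⟩; exact ⟨by omega, h⟩
    · rintro ⟨-, h⟩; exact ⟨by omega, h⟩

theorem IsPattern.one_mem_singles_appendOld {j d k : ℕ} {w : ℕ → ℕ} (h : IsPattern j d w)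
    (hk : k ∈ singles j w) :
    1 ∈ singles (j + 1) (DupSecretary.appendOld j k w) ↔ k ≠ 1 ∧ 1 ∈ singles j w := by
  rw [(h.appendOld hk).mem_singles, h.mem_singles, occ_appendOld]
  rw [h.mem_singles] at hk
  by_cases h1 : k = 1
  · subst h1
    simp [hk.2]
  · simp [h1]

theorem values_congr {j : ℕ} {f g : ℕ → ℕ} (h : ∀ i < j, f i = g i) : values j f = values j g := by
  rw [values, image_congr_range h, values]

theorem wordRank_congr {i : ℕ} {f g : ℕ → ℕ} (h : ∀ l ≤ i, f l = g l) :
    wordRank f i = wordRank g i := by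
  rw [wordRank, image_congr_range (fun l hl => h l (by omega)), h i le_rfl, wordRank]

theorem values_skip (k j : ℕ) (w : ℕ → ℕ) : values j (skip k ∘ w) = values j w := by
  rw [values, ← image_image, card_image_of_injective _ (skip_strictMono k).injective, values]

theorem wordRank_skip (k i : ℕ) (w : ℕ → ℕ) : wordRank (skip k ∘ w) i = wordRank w i := by
  rw [wordRank, ← image_image, filter_image,
    card_image_of_injective _ (skip_strictMono k).injective, wordRank]
  simp [(skip_strictMono k).le_iff_le]

/-- The observations along a word. -/
def wordObs (w : ℕ → ℕ) (i : ℕ) : ℕ × ℕ := (wordRank w i, values (i + 1) w)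

/-- Ranks and counts are invariant under the increasing relabelling `skip k`, so refining a pattern
does not alter past observations. -/
theorem wordObs_insertNew {j k i : ℕ} (w : ℕ → ℕ) (hi : i < j) :
    wordObs (insertNew j k w) i = wordObs w i := by
  have h : ∀ l ≤ i, insertNew j k w l = (skip k ∘ w) l :=
    fun l hl => Function.update_of_ne (by omega) _ _
  rw [wordObs, wordRank_congr h, values_congr (fun l hl => h l (by omega)), values_skip,
    wordRank_skip, wordObs]

theorem wordObs_appendOld {j k i : ℕ} (w : ℕ → ℕ) (hi : i < j) :
    wordObs (appendOld j k w) i = wordObs w i := by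
  have h : ∀ l ≤ i, appendOld j k w l = w l :=
    fun l hl => Function.update_of_ne (by omega) _ _
  rw [wordObs, wordRank_congr h, values_congr (fun l hl => h l (by omega)), wordObs]

/-- The values of a pattern fill an initial segment, so the last letter is its own relative rank and
can be read off the observation. -/
theorem IsPattern.wordRank_last {j d : ℕ} {w : ℕ → ℕ} (h : IsPattern (j + 1) d w) :
    wordRank w j = w j := by
  have h1 : w j ∈ Icc 1 d := by
    rw [← h.image_eq]; exact mem_image_of_mem _ (by simp)
  rw [mem_Icc] at h1
  rw [wordRank, h.image_eq]
  have : (Icc 1 d).filter (· ≤ w j) = Icc 1 (w j) := by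
    ext v; simp only [mem_filter, mem_Icc]; omega
  simp [this]

theorem insertNew_self (j k : ℕ) (w : ℕ → ℕ) : insertNew j k w j = k := Function.update_self ..

theorem appendOld_self (j k : ℕ) (w : ℕ → ℕ) : appendOld j k w j = k := Function.update_self ..

theorem IsPattern.wordObs_insertNew_self {j d k : ℕ} {w : ℕ → ℕ} (h : IsPattern j d w)
    (hk : k ∈ Icc 1 (d + 1)) : wordObs (DupSecretary.insertNew j k w) j = (k, d + 1) := by
  have h1 := h.insertNew hk
  rw [wordObs, h1.wordRank_last, h1.values_eq, insertNew_self]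

theorem IsPattern.wordObs_appendOld_self {j d k : ℕ} {w : ℕ → ℕ} (h : IsPattern j d w)
    (hk : k ∈ singles j w) : wordObs (DupSecretary.appendOld j k w) j = (k, d) := by
  have h1 := h.appendOld hk
  rw [wordObs, h1.wordRank_last, h1.values_eq, appendOld_self]

/-! ### The tree of patterns -/

/-- The patterns of length `j + 1` with at most `n` values that extend a pattern of length `j`. -/
def children (n j : ℕ) (w : ℕ → ℕ) : Set (ℕ → ℕ) :=
  {u | (values j w < n ∧ ∃ k ∈ Icc 1 (values j w + 1), u = insertNew j k w) ∨
    ∃ k ∈ singles j w, u = appendOld j k w}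

open Classical in
/-- The words of length `2 * n` whose pattern extends a given pattern of length `j = 2 * n - m`. -/
noncomputable def leaves (n : ℕ) : ℕ → ℕ → (ℕ → ℕ) → Finset (Fin (2 * n) → ℕ)
  | 0, _, w => {fun i : Fin (2 * n) => w i}
  | m + 1, j, w =>
    (if values j w < n then
      (Icc 1 (values j w + 1)).biUnion fun k => leaves n m (j + 1) (insertNew j k w) else ∅) ∪
    (singles j w).biUnion fun k => leaves n m (j + 1) (appendOld j k w)

theorem mem_leaves_succ {n m j : ℕ} {w : ℕ → ℕ} {s : Fin (2 * n) → ℕ} :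
    s ∈ leaves n (m + 1) j w ↔ ∃ u ∈ children n j w, s ∈ leaves n m (j + 1) u := by
  rw [leaves]
  simp only [mem_union, children, Set.mem_ofPred_eq]
  constructor
  · rintro (h | h)
    · split_ifs at h with h1
      · rw [mem_biUnion] at h
        obtain ⟨k, hk, hs⟩ := h
        exact ⟨_, Or.inl ⟨h1, k, hk, rfl⟩, hs⟩
      · simp at h
    · rw [mem_biUnion] at h
      obtain ⟨k, hk, hs⟩ := h
      exact ⟨_, Or.inr ⟨k, hk, rfl⟩, hs⟩
  · rintro ⟨u, ⟨h1, k, hk, rfl⟩ | ⟨k, hk, rfl⟩, hs⟩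
    · left
      rw [if_pos h1]
      exact mem_biUnion.2 ⟨k, hk, hs⟩
    · right
      exact mem_biUnion.2 ⟨k, hk, hs⟩

theorem IsPattern.exists_of_mem_children {n j d : ℕ} {w u : ℕ → ℕ} (h : IsPattern j d w)
    (hd : d ≤ n) (hu : u ∈ children n j w) : ∃ d' ≤ n, IsPattern (j + 1) d' u := by
  rcases hu with ⟨h1, k, hk, rfl⟩ | ⟨k, hk, rfl⟩
  · rw [h.values_eq] at h1 hk
    exact ⟨d + 1, h1, h.insertNew hk⟩
  · exact ⟨d, hd, h.appendOld hk⟩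

theorem wordObs_of_mem_children {n j i : ℕ} {w u : ℕ → ℕ} (hi : i < j) (hu : u ∈ children n j w) :
    wordObs u i = wordObs w i := by
  rcases hu with ⟨h1, k, hk, rfl⟩ | ⟨k, hk, rfl⟩
  · exact wordObs_insertNew w hi
  · exact wordObs_appendOld w hi

/-- The observations along an ordering of the applicants. -/
def obs {N : ℕ} (s : Fin N → ℕ) (i : Fin N) : ℕ × ℕ := (relRank s i, numDistinct s i)

theorem image_Iic_fin {N : ℕ} (w : ℕ → ℕ) (i : Fin N) :
    (Iic i).image (fun l : Fin N => w l) = (range (i + 1)).image w := by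
  ext v
  simp only [mem_image, mem_Iic, mem_range]
  constructor
  · rintro ⟨l, hl, rfl⟩
    exact ⟨l, by have : (l : ℕ) ≤ i := hl; omega, rfl⟩
  · rintro ⟨l, hl, rfl⟩
    exact ⟨⟨l, by omega⟩, by rw [Fin.le_def]; simp; omega, rfl⟩

theorem obs_restrict {N : ℕ} (w : ℕ → ℕ) (i : Fin N) :
    obs (fun l : Fin N => w l) i = wordObs w i := by
  rw [obs, wordObs, relRank, numDistinct, image_Iic_fin, wordRank, values]

theorem obs_of_mem_leaves {n m : ℕ} {s : Fin (2 * n) → ℕ} : ∀ {j : ℕ} {w : ℕ → ℕ},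
    s ∈ leaves n m j w → ∀ i : Fin (2 * n), (i : ℕ) < j → obs s i = wordObs w i := by
  induction m with
  | zero =>
    intro j w hs i hi
    rw [leaves, mem_singleton] at hs
    rw [hs, obs_restrict]
  | succ m ih =>
    intro j w hs i hi
    obtain ⟨u, hu, hs⟩ := mem_leaves_succ.1 hs
    rw [ih hs i (by omega), wordObs_of_mem_children hi hu]

/-- At full length, counting singles forces d = n and no singles. The converse inclusion is not
needed: the leaves turn out to carry total probability 1. -/
theorem isArrangement_of_mem_leaves {n m : ℕ} {s : Fin (2 * n) → ℕ} : ∀ {j d : ℕ} {w : ℕ → ℕ},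
    IsPattern j d w → d ≤ n → j + m = 2 * n → s ∈ leaves n m j w → IsArrangement n s := by
  induction m with
  | zero =>
    intro j d w h hd hj hs v hv
    rw [leaves, mem_singleton] at hs
    have h1 := h.card_singles
    obtain rfl : d = n := by omega
    have hj' : j = 2 * d := by omega
    have h2 := h.occ_eq_two hj' hv
    subst hj'
    refine Eq.trans ?_ h2
    rw [occ, hs]
    refine card_bij (fun i _ => (i : ℕ)) (by simp) (fun a _ b _ hab => Fin.ext hab) ?_
    intro b hb
    simp only [mem_filter, mem_range] at hb
    exact ⟨⟨b, hb.1⟩, by simpa using hb.2, rfl⟩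
  | succ m ih =>
    intro j d w h hd hj hs
    obtain ⟨u, hu, hs⟩ := mem_leaves_succ.1 hs
    obtain ⟨d', hd', h'⟩ := h.exists_of_mem_children hd hu
    exact ih h' hd' (by omega) hs

/-- Different children give different observations at time j, so their sets of leaves are disjoint.
-/
theorem IsPattern.sum_leaves_succ {n m j d : ℕ} {w : ℕ → ℕ} (h : IsPattern j d w)
    (hj : j + (m + 1) = 2 * n) (F : (Fin (2 * n) → ℕ) → ℝ) :
    ∑ s ∈ leaves n (m + 1) j w, F s =
      (if d < n then
        ∑ k ∈ Icc 1 (d + 1), ∑ s ∈ leaves n m (j + 1) (DupSecretary.insertNew j k w), F s else 0) +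
      ∑ k ∈ singles j w, ∑ s ∈ leaves n m (j + 1) (DupSecretary.appendOld j k w), F s := by
  classical
  have hjn : j < 2 * n := by omega
  have h1 : ∀ k ∈ Icc 1 (d + 1), ∀ s ∈ leaves n m (j + 1) (DupSecretary.insertNew j k w),
      obs s ⟨j, hjn⟩ = (k, d + 1) := fun k hk s hs => by
    rw [obs_of_mem_leaves hs _ (by simp), h.wordObs_insertNew_self hk]
  have h2 : ∀ k ∈ singles j w, ∀ s ∈ leaves n m (j + 1) (DupSecretary.appendOld j k w),
      obs s ⟨j, hjn⟩ = (k, d) := fun k hk s hs => by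
    rw [obs_of_mem_leaves hs _ (by simp), h.wordObs_appendOld_self hk]
  rw [leaves, h.values_eq, sum_union, sum_biUnion]
  · congr 1
    split_ifs
    · rw [sum_biUnion]
      intro a ha b hb hab
      refine disjoint_left.2 fun s hs hs' => hab ?_
      have := (h1 a ha s hs).symm.trans (h1 b hb s hs')
      simpa using this
    · simp
  · intro a ha b hb hab
    refine disjoint_left.2 fun s hs hs' => hab ?_
    have := (h2 a ha s hs).symm.trans (h2 b hb s hs')
    simpa using this
  · refine disjoint_left.2 fun s hs hs' => ?_
    rw [mem_biUnion] at hs'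
    obtain ⟨b, hb, hs'⟩ := hs'
    split_ifs at hs
    · rw [mem_biUnion] at hs
      obtain ⟨a, ha, hs⟩ := hs
      have := (h1 a ha s hs).symm.trans (h2 b hb s hs')
      simp at this
    · simp at hs

/-! ### Counting the leaves -/

/-- The number of orderings whose pattern at time `2 * n - m` is a given one with `d` values. -/
noncomputable def leafCount (n m d : ℕ) : ℝ := (n.choose d : ℝ) * m.factorial / 2 ^ (n - d)

theorem leafCount_nonneg (n m d : ℕ) : 0 ≤ leafCount n m d := by unfold leafCount; positivity

theorem leafCount_succ (n m d : ℕ) :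
    leafCount n (m + 1) d = ((m : ℝ) + 1) * leafCount n m d := by
  unfold leafCount
  rw [Nat.factorial_succ]
  push_cast
  ring

theorem leafCount_add_one {n d : ℕ} (m : ℕ) (h : d < n) :
    ((d : ℝ) + 1) * leafCount n m (d + 1) = 2 * ((n : ℝ) - d) * leafCount n m d := by
  unfold leafCount
  have h1 : (n.choose (d + 1) : ℝ) * (d + 1) = n.choose d * ((n : ℝ) - d) := by
    have := Nat.choose_succ_right_eq n d
    have h2 : ((n - d : ℕ) : ℝ) = (n : ℝ) - d := by push_cast [h.le]; ring
    rw [← h2]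
    exact_mod_cast this
  have h3 : n - d = (n - (d + 1)) + 1 := by omega
  rw [h3, pow_succ]
  field_simp
  linear_combination h1

/-- The m + 1 remaining applicants split into 2(n-d) with unseen values and 2d-j second copies of
singles; `leafCount` satisfies the matching recursion. -/
theorem IsPattern.card_leaves {n m : ℕ} : ∀ {j d : ℕ} {w : ℕ → ℕ}, IsPattern j d w → d ≤ n →
    j + m = 2 * n → ((leaves n m j w).card : ℝ) = leafCount n m d := by
  induction m with
  | zero =>
    intro j d w h hd hj
    have h1 := h.card_singles
    obtain rfl : d = n := by omega
    simp [leaves, leafCount]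
  | succ m ih =>
    intro j d w h hd hj
    have h1 := h.sum_leaves_succ hj fun _ => 1
    simp only [sum_const, nsmul_eq_mul, mul_one] at h1
    have h2 : ((singles j w).card : ℝ) + j = 2 * d := by exact_mod_cast h.card_singles
    have h3 : (j : ℝ) + (m + 1) = 2 * n := by exact_mod_cast hj
    rw [h1, sum_congr rfl fun k hk => ih (h.appendOld hk) hd (by omega), leafCount_succ,
      sum_const, nsmul_eq_mul]
    split_ifs with hdn
    · rw [sum_congr rfl fun k hk => ih (h.insertNew hk) hdn (by omega)]
      have := leafCount_add_one m hdn
      simp only [sum_const, Nat.card_Icc, nsmul_eq_mul]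
      push_cast
      linear_combination this + leafCount n m d * h2 - leafCount n m d * h3
    · have : (d : ℝ) = n := by exact_mod_cast (by omega : d = n)
      linear_combination leafCount n m d * h2 - leafCount n m d * h3 + 2 * leafCount n m d * this

theorem skip_eq_one_iff {k v : ℕ} (hk : 1 ≤ k) (hv : 1 ≤ v) : skip k v = 1 ↔ v = 1 ∧ k ≠ 1 := by
  unfold skip
  split_ifs <;> omega

theorem IsPattern.one_le {j d i : ℕ} {w : ℕ → ℕ} (h : IsPattern j d w) (hi : i < j) :
    1 ≤ w i := by
  have : w i ∈ Icc 1 d := by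
    rw [← h.image_eq]; exact mem_image_of_mem _ (by simpa using hi)
  exact (mem_Icc.1 this).1

/-- Given the pattern, a smallest value has absolute rank `1` with probability `d / n`. -/
theorem IsPattern.sum_leaves_eq_one {n m : ℕ} (i : Fin (2 * n)) : ∀ {j d : ℕ} {w : ℕ → ℕ},
    IsPattern j d w → d ≤ n → j + m = 2 * n → (i : ℕ) < j →
    ∑ s ∈ leaves n m j w, (if s i = 1 then (1 : ℝ) else 0) =
      if w i = 1 then leafCount n m d * (d / n) else 0 := by
  have hn : (n : ℝ) ≠ 0 := by
    have := i.2
    have : n ≠ 0 := by omega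
    exact_mod_cast this
  induction m with
  | zero =>
    intro j d w h hd hj hi
    have h1 := h.card_singles
    obtain rfl : d = n := by omega
    rw [leaves, sum_singleton]
    simp [leafCount, hn]
  | succ m ih =>
    intro j d w h hd hj hi
    have hw := h.one_le hi
    have e1 : ∀ k ∈ singles j w, DupSecretary.appendOld j k w i = w i :=
      fun k _ => Function.update_of_ne (by omega) _ _
    have e2 : ∀ k ∈ Icc 1 (d + 1), (DupSecretary.insertNew j k w i = 1 ↔ w i = 1 ∧ k ≠ 1) := by
      intro k hk
      rw [DupSecretary.insertNew, Function.update_of_ne (by omega)]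
      exact skip_eq_one_iff (mem_Icc.1 hk).1 hw
    rw [h.sum_leaves_succ hj, sum_congr rfl fun k hk =>
      (ih (h.appendOld hk) hd (by omega) (by omega)).trans (by rw [e1 k hk])]
    have h2 : ((singles j w).card : ℝ) + j = 2 * d := by exact_mod_cast h.card_singles
    have h3 : (j : ℝ) + (m + 1) = 2 * n := by exact_mod_cast hj
    have e3 : (if d < n then ∑ k ∈ Icc 1 (d + 1),
        ∑ s ∈ leaves n m (j + 1) (DupSecretary.insertNew j k w),
          (if s i = 1 then (1 : ℝ) else 0) else 0) =
        if w i = 1 then 2 * ((n : ℝ) - d) * leafCount n m d * (d / n) else 0 := by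
      split_ifs with hdn hw1 hw1
      · rw [sum_congr rfl fun k hk =>
          (ih (h.insertNew hk) hdn (by omega) (by omega)).trans
            (if_congr (e2 k hk) rfl rfl)]
        simp only [hw1, true_and]
        rw [← sum_filter, sum_const, nsmul_eq_mul]
        -- Of the d + 1 positions for a new value, exactly d keep the smallest value smallest.
        have : (Icc 1 (d + 1)).filter (· ≠ 1) = Icc 2 (d + 1) := by
          ext v; simp only [mem_filter, mem_Icc]; omega
        rw [this, Nat.card_Icc, ← leafCount_add_one m hdn]
        push_cast
        ring
      · rw [sum_congr rfl fun k hk =>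
          (ih (h.insertNew hk) hdn (by omega) (by omega)).trans
            (if_congr (e2 k hk) rfl rfl)]
        simp [hw1]
      · have : (d : ℝ) = n := by exact_mod_cast (by omega : d = n)
        simp [this]
      · rfl
    rw [e3, sum_const, nsmul_eq_mul, leafCount_succ]
    split_ifs
    · linear_combination leafCount n m d * (d / n) * h2 - leafCount n m d * (d / n) * h3
    · simp

theorem card_leaves_root (n : ℕ) (w : ℕ → ℕ) :
    ((leaves n (2 * n) 0 w).card : ℝ) = (2 * n).factorial / 2 ^ n := by
  rw [(isPattern_zero w).card_leaves (Nat.zero_le n) (by omega)]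
  simp [leafCount]

end DupSecretary

namespace DupSecretary

open Finset

/-! ### The dynamic programming recursion -/

/-- The optimal values with `n - u` values seen, where the smallest of them has been seen once
(first component), respectively twice (second component). -/
noncomputable def dpPair (n : ℕ) : ℕ → ℝ × ℝ
  | 0 => (1, 0)
  | u + 1 =>
    let d : ℝ := n - (u + 1 : ℕ)
    let b : ℝ := ((dpPair n u).1 + d * (dpPair n u).2) / (d + 1)
    ((max (d / n) b + 2 * (u + 1 : ℕ) * (dpPair n u).1) / (2 * (u + 1 : ℕ) + 1), b)

/-- Optimal value with `d` values seen, the smallest of them once. -/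
noncomputable def valOnce (n d : ℕ) : ℝ := (dpPair n (n - d)).1

/-- Optimal value with `d` values seen, the smallest of them twice. -/
noncomputable def valTwice (n d : ℕ) : ℝ := (dpPair n (n - d)).2

theorem valOnce_self (n : ℕ) : valOnce n n = 1 := by simp [valOnce, dpPair]

theorem valTwice_self (n : ℕ) : valTwice n n = 0 := by simp [valTwice, dpPair]

/-- Once the smallest value is used up, only the next new value matters; it is the new smallest with
probability 1/(d+1). -/
theorem valTwice_rec {n d : ℕ} (h : d < n) :
    ((d : ℝ) + 1) * valTwice n d = valOnce n (d + 1) + d * valTwice n (d + 1) := by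
  have h1 : n - d = (n - (d + 1)) + 1 := by omega
  have h2 : ((n : ℝ) - ((n - (d + 1) + 1 : ℕ) : ℝ)) = d := by
    rw [← h1, Nat.cast_sub h.le]; ring
  rw [valTwice, h1, dpPair]
  simp only [h2]
  rw [valOnce, valTwice]
  field_simp

/-- What matters is which comes first among the 2(n-d) applicants with unseen values and the second
copy of the smallest value. -/
theorem valOnce_rec {n d : ℕ} (h : d < n) :
    (2 * ((n : ℝ) - d) + 1) * valOnce n d =
      max ((d : ℝ) / n) (valTwice n d) + 2 * ((n : ℝ) - d) * valOnce n (d + 1) := by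
  have h1 : n - d = (n - (d + 1)) + 1 := by omega
  have h3 : ((n - (d + 1) + 1 : ℕ) : ℝ) = n - d := by rw [← h1, Nat.cast_sub h.le]
  have h2 : ((n : ℝ) - ((n - (d + 1) + 1 : ℕ) : ℝ)) = d := by rw [h3]; ring
  have h4 : (2 * ((n : ℝ) - d) + 1) ≠ 0 := by
    have : (d : ℝ) < n := by exact_mod_cast h
    nlinarith
  have h5 : valTwice n d = (dpPair n (n - (d + 1) + 1)).2 := by rw [valTwice, h1]
  rw [h5, valOnce, h1, dpPair]
  simp only [h2]
  rw [h3, mul_div_cancel₀ _ h4, valOnce]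

/-- The lower bound (2n+d)/(3n) is the value of always stopping at the next second appearance of the
current smallest value: it solves the recursion with the maximum replaced by d/n. -/
theorem valOnce_ge_and_valTwice_nonneg {n d : ℕ} (hd : d ≤ n) :
    (2 * (n : ℝ) + d) / (3 * n) ≤ valOnce n d ∧ 0 ≤ valTwice n d := by
  induction hd using Nat.decreasingInduction with
  | self =>
    rw [valOnce_self, valTwice_self]
    refine ⟨?_, le_rfl⟩
    rcases Nat.eq_zero_or_pos n with rfl | h
    · simp
    · have : (0 : ℝ) < n := by exact_mod_cast h
      rw [div_le_one (by positivity)]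
      linarith
  | of_succ d hd ih =>
    have hn : (0 : ℝ) < n := by exact_mod_cast (by omega : 0 < n)
    have hdn : (d : ℝ) < n := by exact_mod_cast hd
    have e1 := valOnce_rec hd
    have e2 := valTwice_rec hd
    push_cast at ih
    have hA : 0 ≤ valOnce n (d + 1) := le_trans (by positivity) ih.1
    constructor
    · have h1 : (d : ℝ) / n ≤ max ((d : ℝ) / n) (valTwice n d) := le_max_left _ _
      have h2 := mul_le_mul_of_nonneg_left ih.1 (by linarith : 0 ≤ 2 * ((n : ℝ) - d))
      have h3 : (2 * ((n : ℝ) - d) + 1) * ((2 * (n : ℝ) + d) / (3 * n)) =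
          (d : ℝ) / n + 2 * ((n : ℝ) - d) * ((2 * (n : ℝ) + (d + 1)) / (3 * n)) := by
        field_simp
        ring
      have h4 : (2 * ((n : ℝ) - d) + 1) * ((2 * (n : ℝ) + d) / (3 * n)) ≤
        (2 * ((n : ℝ) - d) + 1) * valOnce n d := by rw [h3, e1]; linarith
      exact le_of_mul_le_mul_left h4 (by linarith)
    · have h1 : 0 ≤ ((d : ℝ) + 1) * valTwice n d := by
        rw [e2]; have := ih.2; positivity
      exact nonneg_of_mul_nonneg_right h1 (by positivity)

theorem div_le_valOnce {n d : ℕ} (hd : d ≤ n) : (d : ℝ) / n ≤ valOnce n d := by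
  refine le_trans ?_ (valOnce_ge_and_valTwice_nonneg hd).1
  rcases Nat.eq_zero_or_pos n with rfl | h
  · simp
  · have hn : (0 : ℝ) < n := by exact_mod_cast h
    have hdn : (d : ℝ) ≤ n := by exact_mod_cast hd
    rw [div_le_div_iff₀ hn (by positivity)]
    nlinarith

theorem valTwice_nonneg {n d : ℕ} (hd : d ≤ n) : 0 ≤ valTwice n d :=
  (valOnce_ge_and_valTwice_nonneg hd).2

theorem valOnce_nonneg {n d : ℕ} (hd : d ≤ n) : 0 ≤ valOnce n d :=
  le_trans (by positivity) (div_le_valOnce hd)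

/-! ### The threshold -/

theorem alpha_eq {n i : ℕ} : alpha n i = 2 * (n : ℝ) / i + ∑ l ∈ Ico i n, 1 / (l : ℝ) := by
  rw [alpha]
  congr 1
  have : Icc (i + 1) n = (Ico i n).image (· + 1) := by
    ext v
    simp only [mem_Icc, mem_image, mem_Ico]
    constructor
    · intro h; exact ⟨v - 1, by omega, by omega⟩
    · rintro ⟨l, hl, rfl⟩; omega
  rw [this, sum_image (by intro a _ b _ h; simpa using h)]
  simp

theorem alpha_succ_le {n i : ℕ} (hi : 1 ≤ i) : alpha n (i + 1) ≤ alpha n i := by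
  rw [alpha_eq, alpha_eq]
  have hi' : (0 : ℝ) < i := by exact_mod_cast hi
  have h1 : 2 * (n : ℝ) / (i + 1 : ℕ) ≤ 2 * n / i := by
    push_cast
    gcongr
    linarith
  have h2 : ∑ l ∈ Ico (i + 1) n, 1 / (l : ℝ) ≤ ∑ l ∈ Ico i n, 1 / (l : ℝ) :=
    sum_le_sum_of_subset_of_nonneg (Ico_subset_Ico_left (by omega)) fun _ _ _ => by positivity
  linarith

theorem alpha_anti {n i j : ℕ} (hi : 1 ≤ i) (hij : i ≤ j) : alpha n j ≤ alpha n i := by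
  induction j, hij using Nat.le_induction with
  | base => exact le_rfl
  | succ j hj ih => exact (alpha_succ_le (by omega)).trans ih

theorem threshold_mem {n : ℕ} (hn : 1 ≤ n) :
    1 ≤ threshold n ∧ threshold n ≤ n ∧ alpha n (threshold n) ≤ 5 := by
  have h : ({i : ℕ | 1 ≤ i ∧ i ≤ n ∧ alpha n i ≤ 5} : Set ℕ).Nonempty := by
    refine ⟨n, hn, le_rfl, ?_⟩
    have : (n : ℝ) ≠ 0 := by positivity
    rw [alpha_eq, mul_div_assoc, div_self this]
    norm_num
  exact Nat.sInf_mem h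

theorem threshold_le {n i : ℕ} (h1 : 1 ≤ i) (h2 : i ≤ n) (h3 : alpha n i ≤ 5) :
    threshold n ≤ i := Nat.sInf_le ⟨h1, h2, h3⟩

theorem alpha_le {n d : ℕ} (hn : 1 ≤ n) (h : threshold n ≤ d) : alpha n d ≤ 5 :=
  (alpha_anti (threshold_mem hn).1 h).trans (threshold_mem hn).2.2

theorem lt_alpha {n d : ℕ} (hn : 1 ≤ n) (h1 : 1 ≤ d) (h : d < threshold n) : 5 < alpha n d := by
  by_contra h2
  have := (threshold_mem hn).2.1
  have := threshold_le h1 (by omega) (not_lt.1 h2)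
  omega

/-- Clearing denominators turns the right side into 2n - 2d + dS ≤ 3d; the constant 5 is 2 + 3. -/
theorem alpha_le_iff {n d : ℕ} (hd : 1 ≤ d) (hn : 1 ≤ n) :
    alpha n d ≤ 5 ↔ 1 / (3 * (n : ℝ)) * (2 * n - 2 * d + d * ∑ l ∈ Ico d n, 1 / (l : ℝ)) ≤
      (d : ℝ) / n := by
  have hn' : (0 : ℝ) < n := by exact_mod_cast hn
  have hd' : (0 : ℝ) < d := by exact_mod_cast hd
  rw [alpha_eq, ← mul_le_mul_iff_of_pos_left hd']
  set S := ∑ l ∈ Ico d n, 1 / (l : ℝ)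
  rw [← mul_le_mul_iff_of_pos_left (a := 3 * (n : ℝ)) (b := 1 / (3 * (n : ℝ)) * _) (by positivity)]
  have e1 : (d : ℝ) * (2 * n / d + S) = 2 * n + d * S := by field_simp
  have e2 : 3 * (n : ℝ) * (1 / (3 * n) * (2 * n - 2 * d + d * S)) = 2 * n - 2 * d + d * S := by
    field_simp
  have e3 : 3 * (n : ℝ) * (d / n) = 3 * d := by field_simp
  rw [e1, e2, e3]
  constructor <;> intro h <;> linarith

theorem sum_Ico_inv_succ {n d : ℕ} (h : d < n) :
    ∑ l ∈ Ico d n, 1 / (l : ℝ) = 1 / (d : ℝ) + ∑ l ∈ Ico (d + 1) n, 1 / (l : ℝ) :=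
  sum_eq_sum_Ico_succ_bot h _

/-- The recursion for `valTwice` involves no maximum, so its closed form extends one step below the
threshold. That extra step starts the induction in `le_valTwice`. -/
theorem valTwice_step {n d : ℕ} (hd : 1 ≤ d) (h : d < n)
    (h1 : valOnce n (d + 1) = (2 * n + (d + 1 : ℕ)) / (3 * n))
    (h2 : valTwice n (d + 1) = 1 / (3 * (n : ℝ)) *
      (2 * n - 2 * (d + 1 : ℕ) + (d + 1 : ℕ) * ∑ l ∈ Ico (d + 1) n, 1 / (l : ℝ))) :
    valTwice n d =
      1 / (3 * (n : ℝ)) * (2 * n - 2 * d + d * ∑ l ∈ Ico d n, 1 / (l : ℝ)) := by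
  have hn' : (0 : ℝ) < n := by exact_mod_cast (by omega : 0 < n)
  have hd' : (0 : ℝ) < d := by exact_mod_cast hd
  have e := valTwice_rec h
  rw [h1, h2] at e
  have hd1 : (d : ℝ) + 1 ≠ 0 := by positivity
  refine mul_left_cancel₀ hd1 (e.trans ?_)
  rw [sum_Ico_inv_succ h]
  push_cast
  field_simp
  ring

theorem val_of_threshold_le {n d : ℕ} (hn : 1 ≤ n) (hdn : d ≤ n) : threshold n ≤ d →
    valOnce n d = (2 * n + d) / (3 * n) ∧ valTwice n d =
      1 / (3 * (n : ℝ)) * (2 * n - 2 * d + d * ∑ l ∈ Ico d n, 1 / (l : ℝ)) := by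
  have hn' : (0 : ℝ) < n := by exact_mod_cast hn
  induction hdn using Nat.decreasingInduction with
  | self =>
    intro _
    rw [valOnce_self, valTwice_self]
    constructor
    · field_simp; ring
    · simp
  | of_succ d hd ih =>
    intro hr
    have hd1 : 1 ≤ d := (threshold_mem hn).1.trans hr
    obtain ⟨h1, h2⟩ := ih (by omega)
    have h3 := valTwice_step hd1 hd h1 h2
    refine ⟨?_, h3⟩
    have h4 := (alpha_le_iff hd1 hn).1 (alpha_le hn hr)
    have e := valOnce_rec hd
    rw [h3, max_eq_left h4, h1] at e
    have hdn : (d : ℝ) < n := by exact_mod_cast hd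
    have hne : 2 * ((n : ℝ) - d) + 1 ≠ 0 := by nlinarith
    refine mul_left_cancel₀ hne (e.trans ?_)
    push_cast
    field_simp
    ring

theorem valTwice_le {n d : ℕ} (hn : 1 ≤ n) (hdn : d ≤ n) (h : threshold n ≤ d) :
    valTwice n d ≤ (d : ℝ) / n := by
  rw [(val_of_threshold_le hn hdn h).2]
  exact (alpha_le_iff ((threshold_mem hn).1.trans h) hn).1 (alpha_le hn h)

/-- Just below the threshold the closed form still decides. Further down, dropping the nonnegative
`valOnce` term gives (d+1)·`valTwice n d` ≥ d·`valTwice n (d+1)`, which propagates the bound d/n. -/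
theorem le_valTwice {n d : ℕ} (hn : 1 ≤ n) (hd : d < threshold n) :
    (d : ℝ) / n ≤ valTwice n d := by
  have hr := threshold_mem hn
  have hn' : (0 : ℝ) < n := by exact_mod_cast hn
  have key : ∀ d (_ : d ≤ threshold n - 1), (d : ℝ) / n ≤ valTwice n d := by
    intro d hd
    induction hd using Nat.decreasingInduction with
    | self =>
      rcases Nat.eq_zero_or_pos (threshold n - 1) with h0 | h0
      · rw [h0]; simpa using valTwice_nonneg (Nat.zero_le n)
      · have e : threshold n - 1 + 1 = threshold n := by omega
        obtain ⟨h1, h2⟩ := val_of_threshold_le hn hr.2.1 le_rfl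
        have h3 := valTwice_step (n := n) h0 (by omega) (by rw [e]; exact h1) (by rw [e]; exact h2)
        rw [h3]
        by_contra h4
        exact absurd ((alpha_le_iff h0 hn).2 (not_le.1 h4).le)
          (not_le.2 (lt_alpha hn h0 (by omega)))
    | of_succ d hd ih =>
      have e := valTwice_rec (n := n) (d := d) (by omega)
      have h1 := valOnce_nonneg (n := n) (d := d + 1) (by omega)
      have h2 : ((d : ℝ) + 1) * (d / n) ≤ (d + 1) * valTwice n d := by
        rw [e]
        have := mul_le_mul_of_nonneg_left ih (Nat.cast_nonneg (α := ℝ) d)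
        push_cast at this
        calc ((d : ℝ) + 1) * (d / n) = d * ((d + 1) / n) := by ring
          _ ≤ _ := by linarith
      exact le_of_mul_le_mul_left h2 (by positivity)
  exact key d (by omega)

/-- Here the maximum is `valTwice n d`, so with A, B the two values, (2(n-d)+1)(A_d - B_d) =
2(n-d)(A_{d+1} - B_d), while (d+1)(A_{d+1} - B_d) = d(A_{d+1} - B_{d+1}). -/
theorem val_sub_of_le_threshold {n d : ℕ} (hn : 1 ≤ n) (hd : d ≤ threshold n) :
    valOnce n d - valTwice n d = d * (∏ j ∈ Ico d (threshold n),
        2 * ((n : ℝ) - (j : ℝ)) / (2 * ((n : ℝ) - (j : ℝ)) + 1)) *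
      ((3 - ∑ l ∈ Ico (threshold n) n, 1 / (l : ℝ)) / (3 * n)) := by
  have hr := threshold_mem hn
  have hn' : (0 : ℝ) < n := by exact_mod_cast hn
  induction hd using Nat.decreasingInduction with
  | self =>
    obtain ⟨h1, h2⟩ := val_of_threshold_le hn hr.2.1 le_rfl
    rw [h1, h2]
    simp only [Ico_self, prod_empty, mul_one]
    field_simp
    ring
  | of_succ d hd ih =>
    have e1 := valTwice_rec (n := n) (d := d) (by omega)
    have e2 := valOnce_rec (n := n) (d := d) (by omega)
    rw [max_eq_right (le_valTwice hn hd)] at e2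
    rw [prod_eq_prod_Ico_succ_bot hd]
    set Q := ∏ j ∈ Ico (d + 1) (threshold n), 2 * ((n : ℝ) - (j : ℝ)) / (2 * ((n : ℝ) - (j : ℝ)) + 1)
    set K := (3 - ∑ l ∈ Ico (threshold n) n, 1 / (l : ℝ)) / (3 * n)
    have hdn : (d : ℝ) < n := by exact_mod_cast (by omega : d < n)
    have hne : 2 * ((n : ℝ) - d) + 1 ≠ 0 := by nlinarith
    have hd1 : (d : ℝ) + 1 ≠ 0 := by positivity
    push_cast at ih
    refine mul_left_cancel₀ (mul_ne_zero hd1 hne) ?_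
    have e3 : ((d : ℝ) + 1) * (2 * (n - d) + 1) * (d * (2 * (n - d) / (2 * (n - d) + 1) * Q) * K) =
        d * (2 * (n - d)) * ((d + 1) * Q * K) := by
      field_simp
    rw [e3, ← ih]
    linear_combination (d + 1 : ℝ) * e2 - 2 * ((n : ℝ) - d) * e1

theorem valTwice_eq_sum {n d : ℕ} (hn : 1 ≤ n) (hd : d ≤ threshold n) :
    valTwice n d = valTwice n (threshold n) +
      ∑ i ∈ Ico d (threshold n), (valOnce n (i + 1) - valTwice n (i + 1)) / (i + 1 : ℕ) := by
  have hr := threshold_mem hn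
  induction hd using Nat.decreasingInduction with
  | self => simp
  | of_succ d hd ih =>
    have e1 := valTwice_rec (n := n) (d := d) (by omega)
    rw [sum_eq_sum_Ico_succ_bot hd]
    have hd1 : ((d + 1 : ℕ) : ℝ) ≠ 0 := by positivity
    have : valTwice n d = valTwice n (d + 1) +
        (valOnce n (d + 1) - valTwice n (d + 1)) / (d + 1 : ℕ) := by
      field_simp
      push_cast
      linear_combination e1
    rw [this, ih]
    ring

theorem valTwice_zero {n : ℕ} (hn : 1 ≤ n) :
    valTwice n 0 = 1 / (3 * (n : ℝ)) *
      ((1 - (threshold n : ℝ) + ∑ i ∈ Ico 1 (threshold n), ∏ j ∈ Ico i (threshold n),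
          2 * ((n : ℝ) - (j : ℝ)) / (2 * ((n : ℝ) - (j : ℝ)) + 1))
        * (3 - ∑ l ∈ Ico (threshold n) n, 1 / (l : ℝ)) + 2 * (n : ℝ) + (threshold n : ℝ)) := by
  have hr := threshold_mem hn
  have hn' : (0 : ℝ) < n := by exact_mod_cast hn
  set Q : ℕ → ℝ := fun i => ∏ j ∈ Ico i (threshold n),
    2 * ((n : ℝ) - (j : ℝ)) / (2 * ((n : ℝ) - (j : ℝ)) + 1) with hQ
  set K := (3 - ∑ l ∈ Ico (threshold n) n, 1 / (l : ℝ)) with hK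
  have h1 : ∑ i ∈ Ico 0 (threshold n), (valOnce n (i + 1) - valTwice n (i + 1)) / (i + 1 : ℕ) =
      ∑ i ∈ Ico 0 (threshold n), Q (i + 1) * (K / (3 * n)) := by
    refine sum_congr rfl fun i hi => ?_
    rw [mem_Ico] at hi
    rw [val_sub_of_le_threshold hn (by omega), mul_assoc, mul_div_cancel_left₀ _ (by positivity)]
  have h2 : ∑ i ∈ Ico 0 (threshold n), Q (i + 1) = ∑ i ∈ Ico 1 (threshold n), Q i + 1 := by
    rw [sum_Ico_add' Q 0 (threshold n) 1, sum_Ico_succ_top (by omega)]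
    simp [hQ]
  rw [valTwice_eq_sum hn (Nat.zero_le _), h1, ← sum_mul, h2,
    (val_of_threshold_le hn hr.2.1 le_rfl).2]
  have : ∑ l ∈ Ico (threshold n) n, 1 / (l : ℝ) = 3 - K := by rw [hK]; ring
  rw [this]
  field_simp
  ring

/-! ### Optimality -/

/-- The optimal value of going on from a pattern. -/
noncomputable def contValue (n j d : ℕ) (w : ℕ → ℕ) : ℝ :=
  if 1 ∈ singles j w then valOnce n d else valTwice n d

/-- The value of stopping at the last letter of a pattern of length `j + 1`. -/
noncomputable def stopValue (n j d : ℕ) (w : ℕ → ℕ) : ℝ := if w j = 1 then (d : ℝ) / n else 0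

theorem contValue_nonneg {n d : ℕ} (j : ℕ) (w : ℕ → ℕ) (hd : d ≤ n) : 0 ≤ contValue n j d w := by
  unfold contValue
  split_ifs
  · exact valOnce_nonneg hd
  · exact valTwice_nonneg hd

theorem sum_Icc_ite_one (d : ℕ) (a b : ℝ) :
    ∑ k ∈ Icc 1 (d + 1), (if k = 1 then a else b) = a + d * b := by
  rw [← add_sum_erase _ _ (by simp : 1 ∈ Icc 1 (d + 1)), if_pos rfl]
  congr 1
  rw [sum_congr rfl fun k hk => if_neg (ne_of_mem_erase hk), sum_const, card_erase_of_mem (by simp)]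
  simp

/-- Stopping at a new value never pays: it wins nothing unless the value is smallest, and then
`div_le_valOnce` favours waiting. -/
theorem IsPattern.max_insertNew {n j d k : ℕ} {w : ℕ → ℕ} (h : IsPattern j d w) (hd : d < n)
    (hk : k ∈ Icc 1 (d + 1)) :
    max (stopValue n j (d + 1) (DupSecretary.insertNew j k w))
      (contValue n (j + 1) (d + 1) (DupSecretary.insertNew j k w)) =
    contValue n (j + 1) (d + 1) (DupSecretary.insertNew j k w) := by
  refine max_eq_right ?_
  rw [stopValue, insertNew_self]
  split_ifs with h1
  · rw [contValue, if_pos ((h.one_mem_singles_insertNew hk).2 (Or.inl h1))]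
    exact div_le_valOnce hd
  · exact contValue_nonneg _ _ hd

theorem IsPattern.contValue_insertNew {n j d k : ℕ} {w : ℕ → ℕ} (h : IsPattern j d w)
    (hk : k ∈ Icc 1 (d + 1)) :
    contValue n (j + 1) (d + 1) (DupSecretary.insertNew j k w) =
      if k = 1 then valOnce n (d + 1) else
        if 1 ∈ singles j w then valOnce n (d + 1) else valTwice n (d + 1) := by
  rw [contValue, if_congr (h.one_mem_singles_insertNew hk) rfl rfl]
  split_ifs <;> simp_all

theorem IsPattern.max_appendOld {n j d k : ℕ} {w : ℕ → ℕ} (h : IsPattern j d w) (hd : d ≤ n)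
    (hk : k ∈ singles j w) :
    max (stopValue n j d (DupSecretary.appendOld j k w))
      (contValue n (j + 1) d (DupSecretary.appendOld j k w)) =
    if k = 1 then max ((d : ℝ) / n) (valTwice n d) else contValue n j d w := by
  rw [stopValue, appendOld_self]
  split_ifs with h1
  · rw [contValue, if_neg (by rw [h.one_mem_singles_appendOld hk]; simp [h1])]
  · rw [max_eq_right (contValue_nonneg _ _ hd), contValue, contValue,
      if_congr (h.one_mem_singles_appendOld hk) rfl rfl]
    simp [h1]

/-- The optimality equation. -/
theorem IsPattern.bellman {n m j d : ℕ} {w : ℕ → ℕ} (h : IsPattern j d w) (hd : d ≤ n)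
    (hn : 1 ≤ n) (hj : j + (m + 1) = 2 * n) :
    (if d < n then ∑ k ∈ Icc 1 (d + 1), leafCount n m (d + 1) *
        max (stopValue n j (d + 1) (DupSecretary.insertNew j k w))
          (contValue n (j + 1) (d + 1) (DupSecretary.insertNew j k w)) else 0) +
      ∑ k ∈ singles j w, leafCount n m d *
        max (stopValue n j d (DupSecretary.appendOld j k w))
          (contValue n (j + 1) d (DupSecretary.appendOld j k w)) =
    leafCount n (m + 1) d * contValue n j d w := by
  have hn' : (0 : ℝ) < n := by exact_mod_cast hn
  have h2 : ((singles j w).card : ℝ) + j = 2 * d := by exact_mod_cast h.card_singles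
  have h3 : (j : ℝ) + (m + 1) = 2 * n := by exact_mod_cast hj
  have e1 : (if d < n then ∑ k ∈ Icc 1 (d + 1), leafCount n m (d + 1) *
        max (stopValue n j (d + 1) (DupSecretary.insertNew j k w))
          (contValue n (j + 1) (d + 1) (DupSecretary.insertNew j k w)) else 0) =
      if d < n then leafCount n m (d + 1) * (valOnce n (d + 1) + d *
        if 1 ∈ singles j w then valOnce n (d + 1) else valTwice n (d + 1)) else 0 := by
    split_ifs with hdn <;> first | rfl | skip
    all_goals
      rw [← mul_sum, sum_congr rfl fun k hk =>
        (h.max_insertNew hdn hk).trans (h.contValue_insertNew hk), sum_Icc_ite_one]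
      simp [*]
  rw [e1, ← mul_sum, sum_congr rfl fun k hk => h.max_appendOld hd hk, leafCount_succ]
  by_cases h1 : 1 ∈ singles j w
  · have e2 : contValue n j d w = valOnce n d := if_pos h1
    have hc : 0 < (singles j w).card := card_pos.2 ⟨1, h1⟩
    rw [← add_sum_erase _ _ h1, if_pos rfl,
      sum_congr rfl fun k hk => if_neg (ne_of_mem_erase hk), sum_const, card_erase_of_mem h1,
      nsmul_eq_mul, Nat.cast_sub hc, e2]
    simp only [h1, if_true]
    split_ifs with hdn
    · linear_combination valOnce n (d + 1) * leafCount_add_one m hdn -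
        leafCount n m d * valOnce_rec hdn + leafCount n m d * valOnce n d * (h2 - h3)
    · obtain rfl : d = n := by omega
      rw [valOnce_self, valTwice_self, div_self hn'.ne', max_eq_left zero_le_one]
      linear_combination leafCount d m d * (h2 - h3)
  · have e2 : contValue n j d w = valTwice n d := if_neg h1
    have e3 : ∀ k ∈ singles j w, (if k = 1 then max ((d : ℝ) / n) (valTwice n d) else
        contValue n j d w) = valTwice n d := fun k hk => by
      rw [if_neg (fun hk1 : k = 1 => h1 (hk1 ▸ hk)), e2]
    rw [sum_congr rfl e3, sum_const, nsmul_eq_mul, e2]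
    simp only [h1, if_false]
    split_ifs with hdn
    · linear_combination valTwice n d * leafCount_add_one m hdn -
        leafCount n m (d + 1) * valTwice_rec hdn + leafCount n m d * valTwice n d * (h2 - h3)
    · obtain rfl : d = n := by omega
      rw [valTwice_self]
      ring

/-- The rule that stops at the first `i ≥ j` with `T i s` wins. -/
def WinsFrom {N : ℕ} (T : Fin N → (Fin N → ℕ) → Prop) (j : ℕ) (s : Fin N → ℕ) : Prop :=
  ∃ i : Fin N, j ≤ i ∧ T i s ∧ s i = 1 ∧ ∀ l : Fin N, j ≤ l → l < i → ¬ T l s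

/-- The decision at each time depends only on the observations so far. -/
def IsObservable {N : ℕ} (T : Fin N → (Fin N → ℕ) → Prop) : Prop :=
  ∀ i s s', (∀ l ≤ i, obs s l = obs s' l) → (T i s ↔ T i s')

theorem winsFrom_iff {N j : ℕ} (T : Fin N → (Fin N → ℕ) → Prop) (hj : j < N) (s : Fin N → ℕ) :
    WinsFrom T j s ↔ (T ⟨j, hj⟩ s ∧ s ⟨j, hj⟩ = 1) ∨ (¬ T ⟨j, hj⟩ s ∧ WinsFrom T (j + 1) s) := by
  constructor
  · rintro ⟨i, h1, h2, h3, h4⟩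
    rcases h1.eq_or_lt with h5 | h5
    · have : (⟨j, hj⟩ : Fin N) = i := Fin.ext h5
      rw [this]
      exact Or.inl ⟨h2, h3⟩
    · refine Or.inr ⟨h4 _ le_rfl h5, i, h5, h2, h3, fun l h6 h7 => h4 l (by omega) h7⟩
  · rintro (⟨h1, h2⟩ | ⟨h1, i, h2, h3, h4, h5⟩)
    · refine ⟨_, le_rfl, h1, h2, fun l h3 h4 => ?_⟩
      rw [Fin.lt_def] at h4
      simp at h4
      omega
    · refine ⟨i, by omega, h3, h4, fun l h6 h7 => ?_⟩
      rcases h6.eq_or_lt with h8 | h8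
      · have : (⟨j, hj⟩ : Fin N) = l := Fin.ext h8
        rwa [← this]
      · exact h5 l h8 h7

open Classical in
/-- The number of orderings extending a pattern for which the rule `T`, started after the first
`j` letters, wins. -/
noncomputable def winCount (n : ℕ) (T : Fin (2 * n) → (Fin (2 * n) → ℕ) → Prop) (m i j : ℕ)
    (w : ℕ → ℕ) : ℝ := ∑ s ∈ leaves n m j w, if WinsFrom T i s then 1 else 0

theorem winCount_zero {n : ℕ} {T : Fin (2 * n) → (Fin (2 * n) → ℕ) → Prop} {i : ℕ}
    (hi : 2 * n ≤ i) (m j : ℕ) (w : ℕ → ℕ) : winCount n T m i j w = 0 := by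
  refine sum_eq_zero fun s _ => if_neg ?_
  rintro ⟨l, hl, -⟩
  omega

/-- All leaves share the observations up to time j, so an observable rule stops on all of them or on
none. -/
theorem IsPattern.winCount_of_halt {n m j d : ℕ} {w : ℕ → ℕ} (h : IsPattern (j + 1) d w)
    (hd : d ≤ n) (hj : j + 1 + m = 2 * n) {T : Fin (2 * n) → (Fin (2 * n) → ℕ) → Prop}
    (hT : IsObservable T) (hs : T ⟨j, by omega⟩ fun i => w i) :
    winCount n T m j (j + 1) w = leafCount n m d * stopValue n j d w := by
  classical
  have hjn : j < 2 * n := by omega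
  have h1 := h.sum_leaves_eq_one ⟨j, hjn⟩ hd hj (by simp)
  rw [stopValue, mul_ite, mul_zero, ← h1, winCount]
  refine sum_congr rfl fun s hs' => ?_
  have h2 : T ⟨j, hjn⟩ s := by
    refine (hT _ _ _ fun l hl => ?_).1 hs
    rw [Fin.le_def] at hl
    rw [obs_of_mem_leaves hs' _ (Nat.lt_succ_of_le hl), obs_restrict]
  refine if_congr ?_ rfl rfl
  rw [winsFrom_iff T hjn]
  simp [h2]

theorem winCount_of_not_halt {n m j : ℕ} {w : ℕ → ℕ} (hjn : j < 2 * n)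
    {T : Fin (2 * n) → (Fin (2 * n) → ℕ) → Prop}
    (hT : IsObservable T) (hs : ¬ T ⟨j, hjn⟩ fun i => w i) :
    winCount n T m j (j + 1) w = winCount n T m (j + 1) (j + 1) w := by
  classical
  refine sum_congr rfl fun s hs' => ?_
  have h2 : ¬ T ⟨j, hjn⟩ s := by
    refine fun h3 => hs ((hT _ _ _ fun l hl => ?_).1 h3)
    rw [Fin.le_def] at hl
    rw [obs_of_mem_leaves hs' _ (Nat.lt_succ_of_le hl), obs_restrict]
  refine if_congr ?_ rfl rfl
  rw [winsFrom_iff T hjn]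
  simp [h2]

/-- Backward induction: at each child the rule earns either the stopping or at most the continuation
value, hence at most their maximum. -/
theorem IsPattern.winCount_le {n m : ℕ} (hn : 1 ≤ n)
    {T : Fin (2 * n) → (Fin (2 * n) → ℕ) → Prop} (hT : IsObservable T) : ∀ {j d : ℕ} {w : ℕ → ℕ},
    IsPattern j d w → d ≤ n → j + m = 2 * n →
      winCount n T m j j w ≤ leafCount n m d * contValue n j d w := by
  induction m with
  | zero =>
    intro j d w h hd hj
    rw [winCount_zero (by omega)]
    exact mul_nonneg (leafCount_nonneg _ _ _) (contValue_nonneg _ _ hd)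
  | succ m ih =>
    intro j d w h hd hj
    have key : ∀ {d' : ℕ} {u : ℕ → ℕ}, IsPattern (j + 1) d' u → d' ≤ n →
        winCount n T m j (j + 1) u ≤
          leafCount n m d' * max (stopValue n j d' u) (contValue n (j + 1) d' u) := by
      intro d' u hu hd'
      by_cases hs : T ⟨j, by omega⟩ fun i => u i
      · rw [hu.winCount_of_halt hd' (by omega) hT hs]
        exact mul_le_mul_of_nonneg_left (le_max_left _ _) (leafCount_nonneg _ _ _)
      · rw [winCount_of_not_halt (by omega) hT hs]
        exact (ih hu hd' (by omega)).trans
          (mul_le_mul_of_nonneg_left (le_max_right _ _) (leafCount_nonneg _ _ _))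
    rw [← h.bellman hd hn hj, winCount, h.sum_leaves_succ hj]
    refine add_le_add ?_ (sum_le_sum fun k hk => key (h.appendOld hk) hd)
    split_ifs with hdn
    · exact sum_le_sum fun k hk => key (h.insertNew hk) hdn
    · exact le_rfl

/-- Stop when the smallest value so far is seen for the second time, provided that at least
`threshold n` different values have been seen. -/
def optRule (n : ℕ) (i : Fin (2 * n)) (s : Fin (2 * n) → ℕ) : Prop :=
  (obs s i).1 = 1 ∧ (∃ l : Fin (2 * n), (l : ℕ) + 1 = i ∧ (obs s l).2 = (obs s i).2) ∧
    threshold n ≤ (obs s i).2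

theorem isObservable_optRule (n : ℕ) : IsObservable (optRule n) := by
  intro i s s' h
  unfold optRule
  rw [h i le_rfl]
  refine and_congr_right fun _ => and_congr_left fun _ => exists_congr fun l =>
    and_congr_right fun hl => ?_
  rw [h l (by rw [Fin.le_def]; omega)]

/-- A new value raises the number of distinct values, whereas `optRule` requires it unchanged; this
is how the rule recognises a repetition. -/
theorem IsPattern.not_optRule_insertNew {n j d k : ℕ} {w : ℕ → ℕ} (h : IsPattern j d w)
    (hk : k ∈ Icc 1 (d + 1)) (hj : j < 2 * n) :
    ¬ optRule n ⟨j, hj⟩ fun i => DupSecretary.insertNew j k w i := by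
  rintro ⟨-, ⟨l, hl, h1⟩, -⟩
  simp only at hl
  rw [obs_restrict, obs_restrict, wordObs_insertNew _ (by omega)] at h1
  have h2 := congrArg Prod.snd (h.wordObs_insertNew_self hk)
  have h3 : (wordObs w l).2 = d := by rw [wordObs, hl, h.values_eq]
  rw [h3] at h1
  exact absurd (h1.trans h2) (by simp)

theorem IsPattern.optRule_appendOld {n j d k : ℕ} {w : ℕ → ℕ} (h : IsPattern j d w)
    (hk : k ∈ singles j w) (hj : j < 2 * n) :
    optRule n ⟨j, hj⟩ (fun i => DupSecretary.appendOld j k w i) ↔ k = 1 ∧ threshold n ≤ d := by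
  rw [optRule, obs_restrict]
  simp only [h.wordObs_appendOld_self hk]
  refine and_congr_right fun _ => and_iff_right ?_
  have hj0 : 0 < j := by
    rw [Nat.pos_iff_ne_zero]
    rintro rfl
    simp [singles] at hk
  have hl : j - 1 + 1 = j := by omega
  refine ⟨⟨j - 1, by omega⟩, hl, ?_⟩
  rw [obs_restrict, wordObs_appendOld _ (by simp; omega)]
  simp only [wordObs, hl, h.values_eq]

theorem IsPattern.winCount_optRule {n m : ℕ} (hn : 1 ≤ n) : ∀ {j d : ℕ} {w : ℕ → ℕ},
    IsPattern j d w → d ≤ n → j + m = 2 * n →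
      winCount n (optRule n) m j j w = leafCount n m d * contValue n j d w := by
  have hT := isObservable_optRule n
  induction m with
  | zero =>
    intro j d w h hd hj
    have h1 := h.card_singles
    have h2 : singles j w = ∅ := card_eq_zero.1 (by omega)
    obtain rfl : d = n := by omega
    rw [winCount_zero (by omega), contValue, h2]
    simp [valTwice_self]
  | succ m ih =>
    intro j d w h hd hj
    rw [← h.bellman hd hn hj, winCount, h.sum_leaves_succ hj]
    congr 1
    · split_ifs with hdn
      · refine sum_congr rfl fun k hk => ?_
        rw [h.max_insertNew hdn hk, ← ih (h.insertNew hk) hdn (by omega)]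
        exact winCount_of_not_halt (by omega) hT (h.not_optRule_insertNew hk (by omega))
      · rfl
    · refine sum_congr rfl fun k hk => ?_
      by_cases hs : k = 1 ∧ threshold n ≤ d
      · refine ((h.appendOld hk).winCount_of_halt hd (by omega) hT
          ((h.optRule_appendOld hk (by omega)).2 hs)).trans ?_
        rw [h.max_appendOld hd hk, if_pos hs.1, max_eq_left (valTwice_le hn hd hs.2), stopValue,
          appendOld_self, if_pos hs.1]
      · refine (winCount_of_not_halt (by omega) hT
          (mt (h.optRule_appendOld hk (by omega)).1 hs)).trans ?_
        rw [ih (h.appendOld hk) hd (by omega), max_eq_right]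
        rw [stopValue, appendOld_self]
        split_ifs with h1
        · rw [contValue, if_neg (by rw [h.one_mem_singles_appendOld hk]; simp [h1])]
          exact le_valTwice hn (not_le.1 fun h2 => hs ⟨h1, h2⟩)
        · exact contValue_nonneg _ _ hd

/-- With nothing seen there are no singles, so the start counts as the "twice" state with d = 0. -/
theorem leafCount_mul_contValue_root (n : ℕ) (w : ℕ → ℕ) :
    leafCount n (2 * n) 0 * contValue n 0 0 w =
      ((2 * n).factorial : ℝ) / 2 ^ n * valTwice n 0 := by
  simp [leafCount, contValue, singles]

end DupSecretary

namespace DupSecretary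

open Finset

/-! ### Stopping times -/

section Measure

variable {Ω : Type*} [MeasurableSpace Ω] {P : Measure Ω} [IsProbabilityMeasure P] {n : ℕ}
  {R : Ω → Fin (2 * n) → ℕ}

theorem two_pow_div_mul (n : ℕ) :
    (2 : ℝ) ^ n / ((2 * n).factorial : ℝ) * (((2 * n).factorial : ℝ) / 2 ^ n) = 1 := by
  have h1 : ((2 * n).factorial : ℝ) ≠ 0 := by exact_mod_cast Nat.factorial_ne_zero _
  field_simp

theorem measurableSet_preimage_of_countable {α : Type*} [MeasurableSpace α] [Countable α]
    [MeasurableSingletonClass α] {f : Ω → α} (hf : Measurable f) (A : Set α) :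
    MeasurableSet (f ⁻¹' A) := hf A.to_countable.measurableSet

-- The leaves are arrangements and there are (2n)!/2^n of them, so the law gives them total mass 1
-- and everything else is null.
open Classical in
theorem measureReal_eq_sum_leaves (hR : Measurable R)
    (hlaw : ∀ s : Fin (2 * n) → ℕ, IsArrangement n s →
      P.real {ω | R ω = s} = (2 : ℝ) ^ n / ((2 * n).factorial : ℝ))
    (W : (Fin (2 * n) → ℕ) → Prop) :
    P.real {ω | W (R ω)} = (2 : ℝ) ^ n / ((2 * n).factorial : ℝ) *
      ∑ s ∈ leaves n (2 * n) 0 0, if W s then 1 else 0 := by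
  set L := leaves n (2 * n) 0 0 with hL
  set c := (2 : ℝ) ^ n / ((2 * n).factorial : ℝ)
  have key : ∀ A ⊆ L, P.real (R ⁻¹' A) = c * (A.card : ℝ) := by
    intro A hA
    rw [← sum_measureReal_preimage_singleton A
      (fun s _ => measurableSet_preimage_of_countable hR {s}),
      sum_congr rfl fun s hs => ?_, sum_const, nsmul_eq_mul, mul_comm]
    exact hlaw s (isArrangement_of_mem_leaves (isPattern_zero 0) (Nat.zero_le n) (by omega) (hA hs))
  have h1 : P.real (R ⁻¹' L) = 1 := by
    rw [key L Subset.rfl, hL, card_leaves_root, two_pow_div_mul]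
  have h2 : P.real (R ⁻¹' L)ᶜ = 0 := by
    rw [probReal_compl_eq_one_sub (measurableSet_preimage_of_countable hR _), h1, sub_self]
  have h3 : P.real {ω | W (R ω)} = P.real (R ⁻¹' (L.filter W : Finset _)) := by
    refine le_antisymm ?_ (measureReal_mono fun ω hω => ?_)
    · calc P.real {ω | W (R ω)} ≤ P.real (R ⁻¹' (L.filter W : Finset _) ∪ (R ⁻¹' L)ᶜ) :=
            measureReal_mono fun ω hω => by
              by_cases hω' : R ω ∈ L
              · left
                simpa [hω'] using hω
              · right
                simpa using hω'
        _ ≤ _ := (measureReal_union_le _ _).trans (by rw [h2, add_zero])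
    · simp only [Set.mem_preimage, SetLike.mem_coe, mem_filter] at hω
      exact hω.2
  rw [h3, key _ (filter_subset _ _), sum_boole]

theorem measurableSet_infoFiltration (hR : Measurable R)
    {T : Fin (2 * n) → (Fin (2 * n) → ℕ) → Prop} (hT : IsObservable T) {l i : Fin (2 * n)}
    (hl : l ≤ i) : MeasurableSet[infoFiltration R hR i] {ω | T l (R ω)} := by
  have h : MeasurableSet[infoFiltration R hR l] {ω | T l (R ω)} := by
    rw [infoFiltration, Filtration.natural_eq_comap]
    -- The histories of the orderings on which `T l` holds; the space of histories is countable, so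
    -- every set of them is measurable.
    refine ⟨{v | ∃ s, T l s ∧ v = fun k : Set.Iic l => obs s k},
      (Set.to_countable _).measurableSet, ?_⟩
    ext ω
    constructor
    · rintro ⟨s, hs, hv⟩
      exact (hT l _ _ fun k hk => (congrFun hv ⟨k, hk⟩).symm).1 hs
    · intro hω
      exact ⟨R ω, hω, rfl⟩
  exact (infoFiltration R hR).mono hl _ h

/-- A stopping time that wins whenever the observable rule `T` does: the first time at which `T`
holds, or the last time if there is none. -/
theorem exists_isStoppingTime_of_isObservable (hn : 1 ≤ n) (hR : Measurable R)
    {T : Fin (2 * n) → (Fin (2 * n) → ℕ) → Prop} (hT : IsObservable T) :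
    ∃ τ : Ω → Fin (2 * n),
      IsStoppingTime (infoFiltration R hR) (fun ω => (τ ω : WithTop (Fin (2 * n)))) ∧
      ∀ ω, WinsFrom T 0 (R ω) → R ω (τ ω) = 1 := by
  classical
  let last : Fin (2 * n) := ⟨2 * n - 1, by omega⟩
  let τ : Ω → Fin (2 * n) := fun ω =>
    (insert last (univ.filter fun i => T i (R ω))).min' (insert_nonempty _ _)
  refine ⟨τ, fun i => ?_, fun ω hω => ?_⟩
  · have h : {ω | (τ ω : WithTop (Fin (2 * n))) ≤ i} =
        {_ω | last ≤ i} ∪ ⋃ l ∈ Iic i, {ω | T l (R ω)} := by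
      ext ω
      simp only [Set.mem_ofPred_eq, WithTop.coe_le_coe, Set.mem_union, Set.mem_iUnion, mem_Iic,
        exists_prop]
      constructor
      · intro hω
        have h1 := min'_mem (insert last (univ.filter fun i => T i (R ω))) (insert_nonempty _ _)
        rcases mem_insert.1 h1 with h2 | h2
        · exact Or.inl (h2 ▸ hω)
        · exact Or.inr ⟨τ ω, hω, (mem_filter.1 h2).2⟩
      · rintro (h | ⟨b, hbi, hb⟩)
        · exact (min'_le _ _ (mem_insert_self _ _)).trans h
        · exact (min'_le _ _ (by simp [hb])).trans hbi
    rw [h]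
    refine MeasurableSet.union (MeasurableSet.const _) (Finset.measurableSet_biUnion _ fun l hl => ?_)
    exact measurableSet_infoFiltration hR hT (mem_Iic.1 hl)
  · obtain ⟨i, -, h1, h2, h3⟩ := hω
    have : τ ω = i := by
      refine le_antisymm (min'_le _ _ (by simp [h1])) (le_min' _ _ _ fun l hl => ?_)
      simp only [mem_insert, mem_filter, mem_univ, true_and] at hl
      rcases hl with rfl | hl
      · rw [Fin.le_def]; simp only [last]; omega
      · by_contra h4
        exact h3 l (Nat.zero_le _) (not_le.1 h4) hl
    rw [this, h2]

/-- Each event τ = i is the preimage of a set of histories up to i, and membership of the history in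
that set is the rule. -/
theorem exists_isObservable_of_isStoppingTime (hR : Measurable R) {τ : Ω → Fin (2 * n)}
    (hτ : IsStoppingTime (infoFiltration R hR) (fun ω => (τ ω : WithTop (Fin (2 * n))))) :
    ∃ T : Fin (2 * n) → (Fin (2 * n) → ℕ) → Prop, IsObservable T ∧
      ∀ i ω, T i (R ω) ↔ τ ω = i := by
  have h : ∀ i, ∃ V : Set (Set.Iic i → ℕ × ℕ),
      (fun ω (l : Set.Iic i) => observation R l ω) ⁻¹' V = {ω | τ ω = i} := by
    intro i
    have h1 := hτ.measurableSet_eq_of_countable i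
    rw [infoFiltration, Filtration.natural_eq_comap] at h1
    obtain ⟨V, -, hV⟩ := h1
    refine ⟨V, hV.trans ?_⟩
    ext ω
    simp
  choose V hV using h
  refine ⟨fun i s => (fun l : Set.Iic i => obs s l) ∈ V i, fun i s s' hs => ?_, fun i ω => ?_⟩
  · have : (fun l : Set.Iic i => obs s l) = fun l : Set.Iic i => obs s' l :=
      funext fun l => hs l l.2
    simp only [this]
  · exact Set.ext_iff.1 (hV i) ω

theorem isGreatest_successProbs (hn : 1 ≤ n) (hR : Measurable R)
    (hlaw : ∀ s : Fin (2 * n) → ℕ, IsArrangement n s →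
      P.real {ω | R ω = s} = (2 : ℝ) ^ n / ((2 * n).factorial : ℝ)) :
    IsGreatest (successProbs P R hR) (valTwice n 0) := by
  have h0 : ∀ a : ℝ, (2 : ℝ) ^ n / ((2 * n).factorial : ℝ) *
      (((2 * n).factorial : ℝ) / 2 ^ n * a) = a := fun a => by
    rw [← mul_assoc, two_pow_div_mul, one_mul]
  have hle : ∀ p ∈ successProbs P R hR, p ≤ valTwice n 0 := by
    rintro p ⟨τ, hτ, rfl⟩
    obtain ⟨T, hT, hTτ⟩ := exists_isObservable_of_isStoppingTime hR hτ
    have h1 : {ω | R ω (τ ω) = 1} = {ω | WinsFrom T 0 (R ω)} := by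
      ext ω
      constructor
      · intro hω
        exact ⟨τ ω, Nat.zero_le _, (hTτ _ _).2 rfl, hω,
          fun l _ hl hl' => hl.ne' ((hTτ _ _).1 hl')⟩
      · rintro ⟨i, -, hi, hi', -⟩
        rw [← (hTτ _ _).1 hi] at hi'
        exact hi'
    have h2 := (isPattern_zero 0).winCount_le hn hT (Nat.zero_le n) (zero_add (2 * n))
    rw [leafCount_mul_contValue_root] at h2
    rw [h1, measureReal_eq_sum_leaves hR hlaw, ← h0 (valTwice n 0)]
    exact mul_le_mul_of_nonneg_left h2 (by positivity)
  refine ⟨?_, hle⟩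
  obtain ⟨τ, hτ, hw⟩ := exists_isStoppingTime_of_isObservable hn hR (isObservable_optRule n)
  refine ⟨τ, hτ, le_antisymm ?_ (hle _ ⟨τ, hτ, rfl⟩)⟩
  have h2 := (isPattern_zero 0).winCount_optRule hn (Nat.zero_le n) (zero_add (2 * n))
  rw [leafCount_mul_contValue_root] at h2
  rw [← h0 (valTwice n 0), ← h2, winCount, ← measureReal_eq_sum_leaves hR hlaw]
  exact measureReal_mono hw

theorem isGreatest_maxSuccessProb (hn : 1 ≤ n) (hR : Measurable R)
    (hlaw : ∀ s : Fin (2 * n) → ℕ, IsArrangement n s →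
      P.real {ω | R ω = s} = (2 : ℝ) ^ n / ((2 * n).factorial : ℝ)) :
    IsGreatest (successProbs P R hR) (maxSuccessProb P R hR) ∧
      maxSuccessProb P R hR = valTwice n 0 := by
  have h := isGreatest_successProbs hn hR hlaw
  have h1 : maxSuccessProb P R hR = valTwice n 0 := h.csSup_eq
  exact ⟨h1 ▸ h, h1⟩

end Measure

end DupSecretary

namespace DupSecretary

/-! ### Asymptotics of the threshold -/

/-- The term l = 0 is 1/0 = 0, and the range omits l = n. -/
theorem sum_range_inv_eq (n : ℕ) : ∑ l ∈ Finset.range n, 1 / (l : ℝ) = harmonic n - 1 / n := by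
  induction n with
  | zero => simp
  | succ n ih =>
    rw [Finset.sum_range_succ, ih, harmonic_succ]
    push_cast
    ring

theorem tendsto_sum_range_inv_sub_log :
    Tendsto (fun n : ℕ => ∑ l ∈ Finset.range n, 1 / (l : ℝ) - Real.log n) atTop
      (𝓝 Real.eulerMascheroniConstant) := by
  have h := Real.tendsto_harmonic_sub_log.sub (tendsto_one_div_atTop_nhds_zero_nat (𝕜 := ℝ))
  rw [sub_zero] at h
  refine h.congr fun n => ?_
  rw [sum_range_inv_eq]
  ring

theorem tendsto_atTop_of_div {x : ℝ} (hx : 0 < x) {i : ℕ → ℕ}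
    (h : Tendsto (fun n => (i n : ℝ) / n) atTop (𝓝 x)) : Tendsto i atTop atTop := by
  rw [← tendsto_natCast_atTop_iff (R := ℝ)]
  refine (h.pos_mul_atTop hx tendsto_natCast_atTop_atTop).congr' ?_
  filter_upwards [eventually_ge_atTop 1] with n hn
  have : (n : ℝ) ≠ 0 := by positivity
  field_simp

/-- A difference of two harmonic sums: the Euler constants cancel and log n - log i_n remains. -/
theorem tendsto_sum_Ico_inv {x : ℝ} (hx : 0 < x) {i : ℕ → ℕ} (hi : ∀ᶠ n in atTop, i n ≤ n)
    (h : Tendsto (fun n => (i n : ℝ) / n) atTop (𝓝 x)) :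
    Tendsto (fun n => ∑ l ∈ Finset.Ico (i n) n, 1 / (l : ℝ)) atTop (𝓝 (-Real.log x)) := by
  have hinf := tendsto_atTop_of_div hx h
  have h1 := tendsto_sum_range_inv_sub_log.sub (tendsto_sum_range_inv_sub_log.comp hinf)
  have h2 := (h.log hx.ne').neg
  have h3 := h1.add h2
  rw [sub_self, zero_add] at h3
  refine h3.congr' ?_
  filter_upwards [hi, hinf.eventually_ge_atTop 1, eventually_ge_atTop 1] with n hn h4 h5
  have h6 : (i n : ℝ) ≠ 0 := by positivity
  have h7 : (n : ℝ) ≠ 0 := by positivity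
  rw [Finset.sum_Ico_eq_sub _ hn, Real.log_div h6 h7]
  simp only [Function.comp]
  ring

theorem tendsto_alpha {x : ℝ} (hx : 0 < x) {i : ℕ → ℕ} (hi : ∀ᶠ n in atTop, i n ≤ n)
    (h : Tendsto (fun n => (i n : ℝ) / n) atTop (𝓝 x)) :
    Tendsto (fun n => alpha n (i n)) atTop (𝓝 (2 / x - Real.log x)) := by
  have h1 := (h.inv₀ hx.ne').const_mul 2
  have h2 := h1.add (tendsto_sum_Ico_inv hx hi h)
  rw [← div_eq_mul_inv, ← sub_eq_add_neg] at h2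
  refine h2.congr fun n => ?_
  rw [alpha_eq, inv_div]
  ring

theorem strictAntiOn_two_div_sub_log :
    StrictAntiOn (fun x : ℝ => 2 / x - Real.log x) (Set.Ioi 0) := by
  intro a ha b hb hab
  have ha' : 0 < a := ha
  have h1 : 2 / b < 2 / a := div_lt_div_of_pos_left two_pos ha' hab
  have h2 := Real.log_lt_log ha' hab
  simp only
  linarith

theorem eventually_floor_le {x : ℝ} (hx : x ≤ 1) : ∀ᶠ n : ℕ in atTop, ⌊x * (n : ℝ)⌋₊ ≤ n := by
  refine Eventually.of_forall fun n => ?_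
  refine Nat.floor_le_of_le ?_
  nlinarith [Nat.cast_nonneg (α := ℝ) n]

theorem tendsto_floor_mul_div {x : ℝ} (hx : 0 < x) :
    Tendsto (fun n : ℕ => (⌊x * (n : ℝ)⌋₊ : ℝ) / n) atTop (𝓝 x) :=
  (tendsto_nat_floor_mul_div_atTop hx.le).comp tendsto_natCast_atTop_atTop

/-- For x on either side of r the limit of `alpha n ⌊xn⌋` lies strictly beyond 5, so eventually ⌊xn⌋
lies on the corresponding side of the threshold. -/
theorem tendsto_threshold_div {r : ℝ} (h0 : 0 < r) (h1 : r < 1)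
    (hr : 2 / r - Real.log r = 5) :
    Tendsto (fun n : ℕ => (threshold n : ℝ) / (n : ℝ)) atTop (𝓝 r) := by
  refine tendsto_order.2 ⟨fun a ha => ?_, fun b hb => ?_⟩
  · obtain ⟨x, hx1, hx2⟩ := exists_between (max_lt ha h0)
    obtain ⟨hx1, hx3⟩ := max_lt_iff.1 hx1
    have h2 := strictAntiOn_two_div_sub_log (show x ∈ Set.Ioi 0 from hx3) h0 hx2
    simp only [hr] at h2
    have h3 := (tendsto_alpha hx3 (eventually_floor_le (hx2.trans h1).le)
      (tendsto_floor_mul_div hx3)).eventually (lt_mem_nhds h2)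
    filter_upwards [h3, eventually_ge_atTop 1] with n hn hn1
    have hn0 : (0 : ℝ) < n := by positivity
    rw [lt_div_iff₀ hn0]
    have h4 : ⌊x * (n : ℝ)⌋₊ < threshold n := by
      by_contra h5
      exact absurd (alpha_le hn1 (not_lt.1 h5)) (not_le.2 hn)
    have h5 := (Nat.floor_lt (by positivity)).1 h4
    nlinarith
  · obtain ⟨x, hx1, hx2⟩ := exists_between (lt_min hb h1)
    obtain ⟨hx2, hx3⟩ := lt_min_iff.1 hx2
    have hx0 := h0.trans hx1
    have h2 := strictAntiOn_two_div_sub_log h0 (show x ∈ Set.Ioi 0 from hx0) hx1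
    simp only [hr] at h2
    have h3 := (tendsto_alpha hx0 (eventually_floor_le hx3.le)
      (tendsto_floor_mul_div hx0)).eventually (gt_mem_nhds h2)
    filter_upwards [h3, eventually_ge_atTop 1, eventually_floor_le hx3.le,
      (tendsto_atTop_of_div hx0 (tendsto_floor_mul_div hx0)).eventually_ge_atTop 1]
      with n hn hn1 hn2 hn3
    have hn0 : (0 : ℝ) < n := by positivity
    rw [div_lt_iff₀ hn0]
    have h4 : ((threshold n : ℕ) : ℝ) ≤ (⌊x * (n : ℝ)⌋₊ : ℝ) := by
      exact_mod_cast threshold_le hn3 hn2 hn.le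
    have h5 := Nat.floor_le (by positivity : 0 ≤ x * (n : ℝ))
    nlinarith

/-! ### Asymptotics of the optimal value -/

/-- The probability `2 (n - j) / (2 (n - j) + 1)` that, with `j` values seen, a new value comes
before the second occurrence of the smallest one. -/
noncomputable def newFirst (n j : ℕ) : ℝ := 2 * ((n : ℝ) - (j : ℝ)) / (2 * ((n : ℝ) - (j : ℝ)) + 1)

/-- The sums satisfy S_{t+1} = (S_t + 1) q_t with q_t = `newFirst n t`, and -2(n-t) - 2 is a
particular solution because q_t(2(n-t)+1) = 2(n-t). -/
theorem sum_prod_newFirst {n t : ℕ} (ht : 1 ≤ t) : t ≤ n →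
    ∑ i ∈ Finset.Ico 1 t, ∏ j ∈ Finset.Ico i t, newFirst n j =
      2 * n * ∏ j ∈ Finset.Ico 1 t, newFirst n j - 2 * ((n : ℝ) - t) - 2 := by
  induction t, ht using Nat.le_induction with
  | base => intro _; simp; ring
  | succ t ht ih =>
    intro h
    have h1 := ih (by omega)
    have h2 : ∑ i ∈ Finset.Ico 1 t, ∏ j ∈ Finset.Ico i (t + 1), newFirst n j =
        (∑ i ∈ Finset.Ico 1 t, ∏ j ∈ Finset.Ico i t, newFirst n j) * newFirst n t := by
      rw [Finset.sum_mul]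
      refine Finset.sum_congr rfl fun i hi => ?_
      rw [Finset.prod_Ico_succ_top (by simp at hi; omega)]
    have h3 : newFirst n t * (2 * ((n : ℝ) - t) + 1) = 2 * (n - t) := by
      have : (t : ℝ) < n := by exact_mod_cast h
      exact div_mul_cancel₀ _ (by linarith)
    rw [Finset.sum_Ico_succ_top ht, h2, h1, Finset.prod_Ico_succ_top ht]
    simp only [Nat.Ico_succ_singleton, Finset.prod_singleton]
    push_cast
    linear_combination -h3

/-- The product of the factors `2 k / (2 k + 1)` for `1 ≤ k ≤ m`. -/
noncomputable def wallisRoot (m : ℕ) : ℝ :=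
  ∏ k ∈ Finset.range m, (2 * (k : ℝ) + 2) / (2 * k + 3)

theorem wallisRoot_pos (m : ℕ) : 0 < wallisRoot m := Finset.prod_pos fun k _ => by positivity

theorem wallisRoot_sq (m : ℕ) : wallisRoot m ^ 2 * (2 * m + 1) = Real.Wallis.W m := by
  induction m with
  | zero => simp [wallisRoot, Real.Wallis.W]
  | succ m ih =>
    rw [Real.Wallis.W_succ, ← ih, wallisRoot, Finset.prod_range_succ, ← wallisRoot]
    push_cast
    field_simp
    ring

theorem prod_newFirst {n t : ℕ} (ht : 1 ≤ t) : t ≤ n →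
    (∏ j ∈ Finset.Ico 1 t, newFirst n j) * wallisRoot (n - t) = wallisRoot (n - 1) := by
  induction t, ht using Nat.le_induction with
  | base => intro _; simp
  | succ t ht ih =>
    intro h
    have h1 := ih (by omega)
    have h2 : n - t = (n - (t + 1)) + 1 := by omega
    have h3 : ((n - (t + 1) : ℕ) : ℝ) = n - t - 1 := by
      rw [Nat.cast_sub h]; push_cast; ring
    have h4 : wallisRoot (n - t) = wallisRoot (n - (t + 1)) * newFirst n t := by
      rw [h2, wallisRoot, Finset.prod_range_succ, ← wallisRoot, h3, newFirst]
      congr 2 <;> ring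
    rw [Finset.prod_Ico_succ_top ht, ← h1, h4]
    ring

/-- The squared product is W(n-1)/W(n-t) times (2(n-t)+1)/(2n-1); both Wallis products tend to π/2
and cancel. -/
theorem tendsto_prod_newFirst {r : ℝ} (hr0 : 0 < r) (hr : r < 1) {t : ℕ → ℕ}
    (ht : ∀ᶠ n in atTop, t n ≤ n)
    (h : Tendsto (fun n => (t n : ℝ) / n) atTop (𝓝 r)) :
    Tendsto (fun n => ∏ j ∈ Finset.Ico 1 (t n), newFirst n j) atTop (𝓝 √(1 - r)) := by
  have ht1 := (tendsto_atTop_of_div hr0 h).eventually_ge_atTop 1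
  have hsub : Tendsto (fun n => ((n - t n : ℕ) : ℝ) / n) atTop (𝓝 (1 - r)) := by
    refine (h.const_sub 1).congr' ?_
    filter_upwards [ht, eventually_ge_atTop 1] with n hn hn1
    have : (n : ℝ) ≠ 0 := by positivity
    rw [Nat.cast_sub hn]
    field_simp
  have hinf := tendsto_atTop_of_div (sub_pos.2 hr) hsub
  have hpi : Real.pi / 2 ≠ 0 := by positivity
  have h1 := (Real.Wallis.tendsto_W_nhds_pi_div_two.comp (tendsto_sub_atTop_nat 1)).div
    (Real.Wallis.tendsto_W_nhds_pi_div_two.comp hinf) hpi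
  have h2 : Tendsto (fun n : ℕ => (2 * (((n - t n : ℕ) : ℝ) / n) + 1 / n) / (2 - 1 / (n : ℝ)))
      atTop (𝓝 (1 - r)) := by
    have h3 := tendsto_one_div_atTop_nhds_zero_nat (𝕜 := ℝ)
    have h4 := ((hsub.const_mul 2).add h3).div (h3.const_sub 2) (by norm_num)
    rwa [add_zero, sub_zero, mul_div_cancel_left₀ _ two_ne_zero] at h4
  have h3 := (h1.mul h2).sqrt
  rw [div_self hpi, one_mul] at h3
  refine h3.congr' ?_
  filter_upwards [ht, ht1, eventually_ge_atTop 1] with n hn hn1 hn2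
  have e1 := prod_newFirst hn1 hn
  have e2 := wallisRoot_pos (n - t n)
  have e3 := wallisRoot_pos (n - 1)
  have e4 : ∏ j ∈ Finset.Ico 1 (t n), newFirst n j = wallisRoot (n - 1) / wallisRoot (n - t n) := by
    rw [← e1]; field_simp
  have e5 : (n : ℝ) ≠ 0 := by positivity
  have e6 : 2 * ((n - 1 : ℕ) : ℝ) + 1 = n * (2 - 1 / n) := by
    rw [Nat.cast_sub hn2]; push_cast; field_simp; ring
  have e7 : (2 - 1 / (n : ℝ)) ≠ 0 := by
    have : 1 / (n : ℝ) ≤ 1 := by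
      rw [div_le_one (by positivity)]; exact_mod_cast hn2
    linarith
  have e8 : 2 * ((n - t n : ℕ) : ℝ) + 1 = n * (2 * (((n - t n : ℕ) : ℝ) / n) + 1 / n) := by
    field_simp
  have e9 : (2 * (((n - t n : ℕ) : ℝ) / n) + 1 / n) ≠ 0 := by positivity
  rw [e4, ← Real.sqrt_sq (div_pos e3 e2).le]
  congr 1
  simp only [Pi.div_apply, Function.comp]
  rw [← wallisRoot_sq, ← wallisRoot_sq, e6, e8]
  generalize (2 - 1 / (n : ℝ)) = x at e7 ⊢
  generalize (2 * (((n - t n : ℕ) : ℝ) / n) + 1 / n) = y at e9 ⊢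
  field_simp

theorem tendsto_valTwice_zero {r : ℝ} (h0 : 0 < r) (h1 : r < 1)
    (hr : 2 / r - Real.log r = 5) :
    Tendsto (fun n : ℕ => valTwice n 0) atTop
      (𝓝 (r + 4 / (3 * r) * ((1 - r) ^ (3 / 2 : ℝ) - (1 - r) ^ 2))) := by
  have ht := tendsto_threshold_div h0 h1 hr
  have hle : ∀ᶠ n in atTop, threshold n ≤ n := by
    filter_upwards [eventually_ge_atTop 1] with n hn using (threshold_mem hn).2.1
  have hprod := tendsto_prod_newFirst h0 h1 hle ht
  have hsum := tendsto_sum_Ico_inv h0 hle ht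
  have hinv := tendsto_one_div_atTop_nhds_zero_nat (𝕜 := ℝ)
  have hlim := ((((ht.add (hprod.const_mul 2)).sub hinv).sub_const 2).mul
    (hsum.const_sub 3)).add ((ht.const_add 2))
  have hlim := hlim.const_mul (1 / 3)
  have hpow : (1 - r) ^ (3 / 2 : ℝ) = (1 - r) * √(1 - r) := by
    rw [show (3 / 2 : ℝ) = 1 + 1 / 2 by norm_num, Real.rpow_add (sub_pos.2 h1), Real.rpow_one,
      Real.sqrt_eq_rpow]
  -- The equation for r removes the logarithm from the limit.
  have hlog : Real.log r = 2 / r - 5 := by linarith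
  have e : (1 / 3 : ℝ) * ((r + 2 * √(1 - r) - 0 - 2) * (3 - -Real.log r) + (2 + r)) =
      r + 4 / (3 * r) * ((1 - r) ^ (3 / 2 : ℝ) - (1 - r) ^ 2) := by
    rw [hpow, hlog]
    field_simp
    ring
  rw [e] at hlim
  refine hlim.congr' ?_
  filter_upwards [eventually_ge_atTop 1] with n hn
  have hn0 : (n : ℝ) ≠ 0 := by positivity
  obtain ⟨h2, h3, -⟩ := threshold_mem hn
  have h4 := sum_prod_newFirst h2 h3
  simp only [newFirst] at h4
  rw [valTwice_zero hn, h4]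
  simp only [newFirst]
  field_simp
  ring

/-! ### Numerical bounds -/

theorem log_one_sub_bounds {x : ℝ} (h0 : 0 ≤ x) (h1 : x < 1 / 10) :
    |x + x ^ 2 / 2 + x ^ 3 / 3 + x ^ 4 / 4 + x ^ 5 / 5 + x ^ 6 / 6 + x ^ 7 / 7 +
      Real.log (1 - x)| ≤ x ^ 8 / (9 / 10) := by
  have h := Real.abs_log_sub_add_sum_range_le (x := x) (by rw [abs_of_nonneg h0]; linarith) 7
  rw [abs_of_nonneg h0] at h
  simp only [Finset.sum_range_succ, Finset.sum_range_zero] at h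
  norm_num at h
  refine h.trans ?_
  gcongr
  linarith

theorem five_lt_two_div_sub_log : 5 < 2 / (0.4709265 : ℝ) - Real.log 0.4709265 := by
  have h := (abs_le.1 (log_one_sub_bounds (x := 0.058147) (by norm_num) (by norm_num))).2
  have h2 := Real.log_two_gt_d9
  -- Doubling the argument brings it near 1, where the Taylor bound is sharp: 0.058147 = 1 -
  -- 2·0.4709265.
  have h3 : Real.log 0.4709265 = Real.log (1 - 0.058147) - Real.log 2 := by
    rw [← Real.log_div (by norm_num) (by norm_num)]; norm_num
  rw [h3]
  norm_num at h ⊢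
  linarith

theorem two_div_sub_log_lt_five : 2 / (0.4709266 : ℝ) - Real.log 0.4709266 < 5 := by
  have h := (abs_le.1 (log_one_sub_bounds (x := 0.0581468) (by norm_num) (by norm_num))).1
  have h2 := Real.log_two_lt_d9
  have h3 : Real.log 0.4709266 = Real.log (1 - 0.0581468) - Real.log 2 := by
    rw [← Real.log_div (by norm_num) (by norm_num)]; norm_num
  rw [h3]
  norm_num at h ⊢
  linarith

theorem exists_two_div_sub_log_eq_five :
    ∃ r : ℝ, 0.4709265 < r ∧ r < 0.4709266 ∧ 2 / r - Real.log r = 5 := by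
  have hc : ContinuousOn (fun x : ℝ => 2 / x - Real.log x) (Set.Icc 0.4709265 0.4709266) := by
    have hne : ∀ x ∈ Set.Icc (0.4709265 : ℝ) 0.4709266, x ≠ 0 := fun x hx => by
      have := hx.1
      norm_num at this ⊢
      rintro rfl
      norm_num at this
    exact (continuousOn_const.div continuousOn_id hne).sub (continuousOn_id.log hne)
  obtain ⟨r, hr, hr'⟩ := intermediate_value_Ioo' (by norm_num) hc
    ⟨two_div_sub_log_lt_five, five_lt_two_div_sub_log⟩
  exact ⟨r, hr.1, hr.2, hr'⟩

theorem limit_bounds {r : ℝ} (h1 : 0.4709265 < r) (h2 : r < 0.4709266) :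
    (0.767974 : ℝ) ≤ r + 4 / (3 * r) * ((1 - r) ^ (3 / 2 : ℝ) - (1 - r) ^ 2) ∧
      r + 4 / (3 * r) * ((1 - r) ^ (3 / 2 : ℝ) - (1 - r) ^ 2) < (0.767975 : ℝ) := by
  norm_num at h1 h2
  have hr0 : 0 < r := by linarith
  have hr1 : 0 < 1 - r := by linarith
  have hpow : (1 - r) ^ (3 / 2 : ℝ) = (1 - r) * √(1 - r) := by
    rw [show (3 / 2 : ℝ) = 1 + 1 / 2 by norm_num, Real.rpow_add hr1, Real.rpow_one,
      Real.sqrt_eq_rpow]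
  have hsq : √(1 - r) ^ 2 = 1 - r := Real.sq_sqrt hr1.le
  have hl : (0.72737431 : ℝ) < √(1 - r) := by
    refine Real.lt_sqrt_of_sq_lt ?_
    norm_num
    linarith
  have hu : √(1 - r) < (0.72737439 : ℝ) := by
    rw [Real.sqrt_lt' (by norm_num)]
    norm_num
    linarith
  rw [hpow]
  set s := √(1 - r)
  have hs0 : 0 < s := lt_trans (by norm_num) hl
  have hrs : r = (1 - s) * (1 + s) := by linear_combination hsq
  -- Since r = (1-s)(1+s), the factor 1-s cancels; numerator and denominator can then be bounded
  -- separately.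
  have e : r + 4 / (3 * r) * ((1 - r) * s - (1 - r) ^ 2) = r + 4 * s ^ 3 / (3 * (1 + s)) := by
    have h3 : 1 - s ≠ 0 := by
      have : s < 1 := hu.trans (by norm_num)
      linarith
    rw [← hsq]
    congr 1
    rw [hrs]
    field_simp
  rw [e]
  constructor
  · have h3 : 4 * (0.72737431 : ℝ) ^ 3 / (3 * (1 + 0.72737439)) ≤ 4 * s ^ 3 / (3 * (1 + s)) := by
      gcongr
    norm_num at h3 ⊢
    linarith
  · have h3 : 4 * s ^ 3 / (3 * (1 + s)) ≤ 4 * (0.72737439 : ℝ) ^ 3 / (3 * (1 + 0.72737431)) := by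
      gcongr
    norm_num at h3 ⊢
    linarith

end DupSecretary

/-! ### The exact value and its limit combined -/

theorem theorem2p3 {Ω : ℕ → Type*} [∀ n, MeasurableSpace (Ω n)]
    (P : ∀ n, Measure (Ω n)) [∀ n, IsProbabilityMeasure (P n)]
    (R : ∀ n, Ω n → Fin (2 * n) → ℕ) (hR : ∀ n, Measurable (R n))
    (hlaw : ∀ (n : ℕ) (s : Fin (2 * n) → ℕ), DupSecretary.IsArrangement n s →
      (P n).real {ω | R n ω = s} = (2 : ℝ) ^ n / ((2 * n).factorial : ℝ)) :
    (∀ n : ℕ, 1 ≤ n →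
      IsGreatest (DupSecretary.successProbs (P n) (R n) (hR n))
          (DupSecretary.maxSuccessProb (P n) (R n) (hR n)) ∧
        DupSecretary.maxSuccessProb (P n) (R n) (hR n) =
          1 / (3 * (n : ℝ)) *
            ((1 - (DupSecretary.threshold n : ℝ)
                + ∑ i ∈ Finset.Ico 1 (DupSecretary.threshold n),
                    ∏ j ∈ Finset.Ico i (DupSecretary.threshold n),
                      2 * ((n : ℝ) - (j : ℝ)) / (2 * ((n : ℝ) - (j : ℝ)) + 1))
              * (3 - ∑ l ∈ Finset.Ico (DupSecretary.threshold n) n, 1 / (l : ℝ))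
              + 2 * (n : ℝ) + (DupSecretary.threshold n : ℝ))) ∧
    ∃ r : ℝ, 0 < r ∧ r < 1 ∧
      Tendsto (fun n : ℕ => (DupSecretary.threshold n : ℝ) / (n : ℝ)) atTop (𝓝 r) ∧
      r * Real.exp (-2 / r) = Real.exp (-5) ∧
      Tendsto (fun n : ℕ => DupSecretary.maxSuccessProb (P n) (R n) (hR n)) atTop
        (𝓝 (r + 4 / (3 * r) * ((1 - r) ^ (3 / 2 : ℝ) - (1 - r) ^ 2))) ∧
      (0.767974 : ℝ) ≤ r + 4 / (3 * r) * ((1 - r) ^ (3 / 2 : ℝ) - (1 - r) ^ 2) ∧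
      r + 4 / (3 * r) * ((1 - r) ^ (3 / 2 : ℝ) - (1 - r) ^ 2) < (0.767975 : ℝ) := by
  refine ⟨fun n hn => ?_, ?_⟩
  · obtain ⟨h1, h2⟩ := DupSecretary.isGreatest_maxSuccessProb hn (hR n) (hlaw n)
    exact ⟨h1, h2.trans (DupSecretary.valTwice_zero hn)⟩
  · obtain ⟨r, h1, h2, hr⟩ := DupSecretary.exists_two_div_sub_log_eq_five
    have h0 : 0 < r := lt_trans (by norm_num) h1
    have h3 : r < 1 := h2.trans (by norm_num)
    obtain ⟨h4, h5⟩ := DupSecretary.limit_bounds h1 h2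
    refine ⟨r, h0, h3, DupSecretary.tendsto_threshold_div h0 h3 hr, ?_, ?_, h4, h5⟩
    · have h6 : Real.log r = 2 / r - 5 := by linarith
      calc r * Real.exp (-2 / r) = Real.exp (Real.log r) * Real.exp (-2 / r) := by
            rw [Real.exp_log h0]
        _ = Real.exp (-5) := by
            rw [← Real.exp_add, h6]
            congr 1
            ring
    · refine (DupSecretary.tendsto_valTwice_zero h0 h3 hr).congr' ?_
      filter_upwards [eventually_ge_atTop 1] with n hn
      exact (DupSecretary.isGreatest_maxSuccessProb hn (hR n) (hlaw n)).2.symm
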